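/- Fix $\mu>1$ and $\rho\in(0,1)$. For an integer $N\ge 2$ put $\Lambda=\mathbb Z/N\mathbb Z$, $\gamma=\mu\gamma_1^N$ with $\gamma_1^N=\dfrac{1}{2\sin^2(\pi/N)}$, and for $x\in\mathbb R^{\Lambda}\cong\mathbb R^N$ $$F_{\gamma,N}(x)=\sum_{i\in\Lambda}\Big(\tfrac14x_i^4-\tfrac12x_i^2\Big)+\frac{\gamma}{4}\sum_{i\in\Lambda}(x_i-x_{i+1})^2,\qquad G_{\gamma,N}=\tfrac1N F_{\gamma,N}.$$ Let $I_\pm=\pm(1,\dots,1)$ and let $B^N_\pm$ be the open Euclidean ball of radius $\rho\sqrt N$ around $I_\pm$. For $\varepsilon>0$ let $\mathcal H$ be the set of $h\in W^{1,2}(\mathbb R^N,e^{-G_{\gamma,N}(x)/\varepsilon}dx)$ with values in $[0,1]$, $h=1$ on $B^N_-$ and $h=0$ on $B^N_+$, and let $h^*_{B^N_-,B^N_+}$ be the equilibrium potential, i.e. the minimizer over $\mathcal H$ (which exists, and is determined up to null sets) of the Dirichlet form $$\Phi(h)=\varepsilon\int_{(B^N_-\cup B^N_+)^c}e^{-G_{\gamma,N}(x)/\varepsilon}\,\|\nabla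 h(x)\|_2^2\,dx .$$ Then there exist constants $A_6<\infty$ and $\varepsilon_0>0$, not depending on $N$ (they may depend on $\mu$ and $\rho$), such that for all $0<\varepsilon<\varepsilon_0$ and all $N\ge2$, $$\frac{1}{N^{N/2}}\int_{(B^N_+)^c}h^*_{B^N_-,B^N_+}(x)\,e^{-G_{\gamma,N}(x)/\varepsilon}\,dx=\frac{(2\pi\varepsilon)^{N/2}\,e^{1/(4\varepsilon)}}{\sqrt{\det\nabla^2F_{\gamma,N}(I_-)}}\,\big(1+R(N,\varepsilon)\big),\qquad |R(N,\varepsilon)|\le A_6\sqrt{\varepsilon|\ln\varepsilon|^3}.$$ -/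

import Mathlib

open MeasureTheory Set
open scoped ContDiff

noncomputable section

namespace CoupledBistable

/-- `ℝ^Λ` with `Λ = ℤ/Nℤ`, with the Euclidean norm and Lebesgue measure. -/
abbrev Conf (N : ℕ) : Type := EuclideanSpace ℝ (ZMod N)

variable {N : ℕ} [NeZero N]

/-- The potential `F_{γ,N}` of the chain of coupled bistable particles. -/
def potentialF (γ : ℝ) (x : Conf N) : ℝ :=
  ∑ i : ZMod N, ((1 / 4 : ℝ) * x i ^ 4 - (1 / 2 : ℝ) * x i ^ 2)
    + γ / 4 * ∑ i : ZMod N, (x i - x (i + 1)) ^ 2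

/-- The rescaled potential `G_{γ,N} = F_{γ,N} / N`. -/
def potentialG (γ : ℝ) (x : Conf N) : ℝ := (N : ℝ)⁻¹ * potentialF γ x

/-- The minimum `I_- = -(1,…,1)`. -/
def Iminus (N : ℕ) : Conf N := WithLp.toLp 2 fun _ => (-1 : ℝ)

/-- The minimum `I_+ = (1,…,1)`. -/
def Iplus (N : ℕ) : Conf N := WithLp.toLp 2 fun _ => (1 : ℝ)

/-- The open ball `B^N_-` of radius `ρ √N` around `I_-`. -/
def Bminus (N : ℕ) [NeZero N] (ρ : ℝ) : Set (Conf N) := Metric.ball (Iminus N) (ρ * √(N : ℝ))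

/-- The open ball `B^N_+` of radius `ρ √N` around `I_+`. -/
def Bplus (N : ℕ) [NeZero N] (ρ : ℝ) : Set (Conf N) := Metric.ball (Iplus N) (ρ * √(N : ℝ))

/-- The synchronization threshold `γ_1^N = 1 / (2 sin² (π / N))`. -/
def gammaOne (N : ℕ) : ℝ := 1 / (2 * Real.sin (Real.pi / (N : ℝ)) ^ 2)

/-- The Hessian matrix `(∂_i ∂_j f (x))_{i,j}`. -/
def hessian (f : Conf N → ℝ) (x : Conf N) : Matrix (ZMod N) (ZMod N) ℝ :=
  Matrix.of fun i j =>
    fderiv ℝ (fun y => fderiv ℝ f y (EuclideanSpace.single j (1 : ℝ))) x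
      (EuclideanSpace.single i (1 : ℝ))

/-- The measure `e^{-V(x)/ε} dx`. -/
def gibbs (V : Conf N → ℝ) (ε : ℝ) : Measure (Conf N) :=
  volume.withDensity fun x => ENNReal.ofReal (Real.exp (-V x / ε))

/-- `g` is the weak (distributional) gradient of `h` on the whole space. -/
structure HasWeakGradient (h : Conf N → ℝ) (g : Conf N → Conf N) : Prop where
  locallyIntegrable : LocallyIntegrable h volume
  locallyIntegrable_grad : LocallyIntegrable g volume
  integral_eq : ∀ φ : Conf N → ℝ, ContDiff ℝ ∞ φ → HasCompactSupport φ →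
    ∫ x, h x • gradient φ x = -∫ x, φ x • g x

/-- `h` belongs to the class `𝓗` of functions in the weighted Sobolev space
`W^{1,2}(ℝ^N, e^{-V/ε} dx)` with values in `[0,1]`, equal to `1` on `A` and to `0` on `D`,
and its weak gradient is `g`. -/
structure IsAdmissible (V : Conf N → ℝ) (ε : ℝ) (A D : Set (Conf N))
    (h : Conf N → ℝ) (g : Conf N → Conf N) : Prop where
  hasWeakGradient : HasWeakGradient h g
  memLp : MemLp h 2 (gibbs V ε)
  memLp_grad : MemLp g 2 (gibbs V ε)
  mem_Icc : ∀ x, h x ∈ Icc (0 : ℝ) 1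
  eq_one : ∀ x ∈ A, h x = 1
  eq_zero : ∀ x ∈ D, h x = 0

/-- The Dirichlet form `Φ(h) = ε ∫_{(A ∪ D)^c} e^{-V/ε} ‖∇h‖² dx`, in terms of `g = ∇h`. -/
def dirichletForm (V : Conf N → ℝ) (ε : ℝ) (A D : Set (Conf N)) (g : Conf N → Conf N) : ℝ :=
  ε * ∫ x in (A ∪ D)ᶜ, Real.exp (-V x / ε) * ‖g x‖ ^ 2

/-- `h` is the equilibrium potential `h^*_{A,D}` of the diffusion with drift `-∇V` and noise
intensity `ε`, i.e. the minimizer of the Dirichlet form over the class `𝓗`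
(determined up to a Lebesgue null set). -/
def IsEquilibriumPotential (V : Conf N → ℝ) (ε : ℝ) (A D : Set (Conf N))
    (h : Conf N → ℝ) : Prop :=
  ∃ g, IsAdmissible V ε A D h g ∧
    ∀ h' g', IsAdmissible V ε A D h' g' →
      dirichletForm V ε A D g ≤ dirichletForm V ε A D g'

end CoupledBistable

end

/-! The estimate is a Laplace asymptotic around `I_-`, uniform in the dimension. Put x = I_- + z. By
`exp_neg_potentialG_Iminus_add` the weight is e^{1/(4ε)} e^{X(z)} w(z), with w the Gaussian density
of precision ∇²F(I_-)/(Nε) and X = (Nε)⁻¹ ∑ (z_i³ - z_i⁴/4). The integral of w gives the leading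
term, so what remains is to compare ∫ u e^X w with ∫ w, where u is the translate of the potential,
cut off on the ball around `I_+`. Of the equilibrium potential only measurability, values in [0,1]
and the values on the two balls are used; minimality matters only for existence.

Since |e^X - 1| ≤ |X|(1 + e^X), the error is at most ∫ (1-u) w + ∫ |X| w + ∫ |X| u e^X w. The last
term has no Gaussian weight of its own, but outside the ball around `I_+` one has e^X w ≤ w' for a
second Gaussian density w' (`lowerMatrix_le`). This uses μ > 1: by the sharp Wirtinger inequality
the coupling beats the negative curvature of the double well transversally to the diagonal, and
excluding the ball gives coercivity along it.

Uniformity in N comes from a discrete Sobolev inequality. The coupling is of order N², so under both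
Gaussians each coordinate has second moment O(ε), and N coordinates cancel the factor 1/N in X: the
mean of |X| is O(√ε), and that of 1-u is O(ε). The normalizations of w and w' compare up to a
constant (`integral_gaussDensity_le_of_le_add`). `abs_integral_mass_sub_le` collects this into a
relative error O(√ε), stronger than required.

Existence of the equilibrium potential is the direct method in the Hilbert space of pairs (h, ∇h)
(`exists_isEquilibriumPotential`). -/

noncomputable section

namespace CoupledBistable

/-! ### Gaussian integrals and moments under a coordinatewise bound on the precision matrix -/

section Gaussian

open Matrix

variable {ι : Type*} [Fintype ι]

/-- The unnormalized centred Gaussian density `exp (-⟨w, A w⟩ / 2)` with precision matrix `A`. -/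
def gaussDensity (A : Matrix ι ι ℝ) (w : EuclideanSpace ℝ ι) : ℝ :=
  Real.exp (-(w.ofLp ⬝ᵥ A *ᵥ w.ofLp) / 2)

lemma gaussDensity_pos (A : Matrix ι ι ℝ) (w : EuclideanSpace ℝ ι) : 0 < gaussDensity A w :=
  Real.exp_pos _

lemma continuous_gaussDensity (A : Matrix ι ι ℝ) : Continuous (gaussDensity A) := by
  unfold gaussDensity dotProduct mulVec dotProduct
  fun_prop

lemma integrable_exp_neg_half_sq_norm :
    Integrable (fun w : EuclideanSpace ℝ ι => Real.exp (-(1 / 2) * ‖w‖ ^ 2)) := by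
  have := (GaussianFourier.integrable_cexp_neg_mul_sq_norm_add (V := EuclideanSpace ℝ ι)
    (b := ((1 / 2 : ℝ) : ℂ)) (by norm_num) 0 0).norm
  refine this.congr (Filter.Eventually.of_forall fun w => ?_)
  simp only [Complex.norm_exp]
  congr 1
  simp [← Complex.ofReal_pow]

variable [DecidableEq ι]

lemma exists_eq_transpose_mul_self {A : Matrix ι ι ℝ} (hA : A.PosDef) :
    ∃ B : Matrix ι ι ℝ, A = Bᵀ * B := by
  open scoped MatrixOrder in
  obtain ⟨B, hB⟩ := CStarAlgebra.nonneg_iff_eq_star_mul_self.1 hA.posSemidef.nonneg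
  exact ⟨B, by rw [hB, star_eq_conjTranspose, conjTranspose_eq_transpose_of_trivial]⟩

lemma gaussDensity_transpose_mul_self (B : Matrix ι ι ℝ) (w : EuclideanSpace ℝ ι) :
    gaussDensity (Bᵀ * B) w = Real.exp (-(1 / 2) * ‖Matrix.toLpLin 2 2 B w‖ ^ 2) := by
  rw [gaussDensity, EuclideanSpace.real_norm_sq_eq, ← Matrix.mulVec_mulVec,
    Matrix.dotProduct_mulVec, Matrix.vecMul_transpose]
  congr 1
  simp only [toLpLin_apply, dotProduct, pow_two]
  ring

lemma map_toLpLin_volume {B : Matrix ι ι ℝ} (hB : B.det ≠ 0) :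
    Measure.map (Matrix.toLpLin 2 2 B) (volume : Measure (EuclideanSpace ℝ ι))
      = ENNReal.ofReal |B.det⁻¹| • volume := by
  have := Measure.map_linearMap_addHaar_eq_smul_addHaar
    (volume : Measure (EuclideanSpace ℝ ι)) (f := Matrix.toLpLin 2 2 B)
    (by rwa [LinearMap.det_toLpLin])
  rwa [LinearMap.det_toLpLin] at this

lemma integrable_gaussDensity {A : Matrix ι ι ℝ} (hA : A.PosDef) :
    Integrable (gaussDensity A) := by
  obtain ⟨B, rfl⟩ := exists_eq_transpose_mul_self hA
  have hdet : B.det ≠ 0 := fun h => by simpa [h] using hA.det_pos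
  have hc : Continuous (Matrix.toLpLin 2 2 B : EuclideanSpace ℝ ι → EuclideanSpace ℝ ι) :=
    LinearMap.continuous_of_finiteDimensional _
  have h := integrable_exp_neg_half_sq_norm (ι := ι)
  have h2 : Integrable (fun w : EuclideanSpace ℝ ι => Real.exp (-(1 / 2) * ‖w‖ ^ 2))
      (Measure.map (Matrix.toLpLin 2 2 B) volume) := by
    rw [map_toLpLin_volume hdet]
    exact h.smul_measure ENNReal.ofReal_ne_top
  refine (h2.comp_measurable hc.measurable).congr (Filter.Eventually.of_forall fun w => ?_)
  exact (gaussDensity_transpose_mul_self B w).symm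

lemma integral_gaussDensity {A : Matrix ι ι ℝ} (hA : A.PosDef) :
    ∫ w, gaussDensity A w = √(2 * Real.pi) ^ Fintype.card ι / √A.det := by
  obtain ⟨B, rfl⟩ := exists_eq_transpose_mul_self hA
  have hdet : B.det ≠ 0 := fun h => by simpa [h] using hA.det_pos
  have hc : Continuous (Matrix.toLpLin 2 2 B : EuclideanSpace ℝ ι → EuclideanSpace ℝ ι) :=
    LinearMap.continuous_of_finiteDimensional _
  have h := integral_map (μ := (volume : Measure (EuclideanSpace ℝ ι))) hc.measurable.aemeasurable
    (f := fun w : EuclideanSpace ℝ ι => Real.exp (-(1 / 2) * ‖w‖ ^ 2))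
    (Continuous.aestronglyMeasurable (by fun_prop))
  simp only [gaussDensity_transpose_mul_self]
  rw [← h, map_toLpLin_volume hdet, integral_smul_measure,
    GaussianFourier.integral_rexp_neg_mul_sq_norm (by norm_num), det_mul, det_transpose,
    Real.sqrt_mul_self_eq_abs, ENNReal.toReal_ofReal (abs_nonneg _), abs_inv,
    finrank_euclideanSpace, smul_eq_mul, inv_mul_eq_div]
  congr 1
  rw [Real.sqrt_eq_rpow, ← Real.rpow_natCast, ← Real.rpow_mul (by positivity)]
  congr 1 <;> ring

lemma gaussDensity_sub_smul_vecMulVec (A : Matrix ι ι ℝ) (t : ℝ) (i : ι)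
    (w : EuclideanSpace ℝ ι) :
    gaussDensity (A - t • vecMulVec (Pi.single i 1) (Pi.single i 1)) w
      = Real.exp (t * w i ^ 2 / 2) * gaussDensity A w := by
  rw [gaussDensity, gaussDensity, ← Real.exp_add]
  congr 1
  rw [sub_mulVec, dotProduct_sub, smul_mulVec, vecMulVec_mulVec]
  simp only [dotProduct_smul, single_one_dotProduct, smul_eq_mul,
    dotProduct_single, op_smul_eq_smul, mul_one]
  ring

lemma posDef_sub_smul_vecMulVec {A : Matrix ι ι ℝ} (hA : A.PosDef) {K : ℝ} (hK : 0 < K) {i : ι}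
    (hb : ∀ w : ι → ℝ, w i ^ 2 ≤ K * (w ⬝ᵥ A *ᵥ w)) :
    (A - (1 / (2 * K)) • vecMulVec (Pi.single i 1) (Pi.single i 1)).PosDef := by
  refine PosDef.of_dotProduct_mulVec_pos ?_ fun w hw => ?_
  · refine hA.isHermitian.sub ?_
    ext a b
    simp [vecMulVec_apply, mul_comm]
  · have h1 := hA.dotProduct_mulVec_pos hw
    have h2 := hb w
    simp only [star_trivial] at h1 ⊢
    rw [sub_mulVec, dotProduct_sub, smul_mulVec, vecMulVec_mulVec]
    simp only [dotProduct_smul, single_one_dotProduct, smul_eq_mul, dotProduct_single,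
      op_smul_eq_smul, mul_one]
    have : 1 / (2 * K) * (w i * w i) ≤ 1 / (2 * K) * (K * (w ⬝ᵥ A *ᵥ w)) := by
      refine mul_le_mul_of_nonneg_left ?_ (by positivity)
      rwa [← pow_two]
    have h3 : 1 / (2 * K) * (K * (w ⬝ᵥ A *ᵥ w)) = (w ⬝ᵥ A *ᵥ w) / 2 := by field_simp
    linarith

/-- By the matrix determinant lemma the update multiplies det A by 1 - (A⁻¹)_{ii}/(2K). Testing the
hypothesis on w = A⁻¹e_i gives (A⁻¹)_{ii} ≤ K. -/
lemma half_det_le_det_sub {A : Matrix ι ι ℝ} (hA : A.PosDef) {K : ℝ} (hK : 0 < K) {i : ι}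
    (hb : ∀ w : ι → ℝ, w i ^ 2 ≤ K * (w ⬝ᵥ A *ᵥ w)) :
    A.det / 2 ≤ (A - (1 / (2 * K)) • vecMulVec (Pi.single i 1) (Pi.single i 1)).det := by
  have hu : IsUnit A.det := hA.det_pos.ne'.isUnit
  set e : ι → ℝ := Pi.single i 1 with he
  have key : (A⁻¹ *ᵥ e) i ≤ K := by
    have h := hb (A⁻¹ *ᵥ e)
    rw [mulVec_mulVec, mul_nonsing_inv _ hu, one_mulVec, he, dotProduct_single_one] at h
    by_contra! hlt
    have : 0 < (A⁻¹ *ᵥ e) i := hK.trans hlt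
    nlinarith
  have hd : (A - (1 / (2 * K)) • vecMulVec e e).det
      = A.det * (1 - 1 / (2 * K) * (A⁻¹ *ᵥ e) i) := by
    have h0 : A - (1 / (2 * K)) • vecMulVec e e
        = A * (1 + replicateCol Unit (A⁻¹ *ᵥ e) * replicateRow Unit (-(1 / (2 * K)) • e)) := by
      rw [← vecMulVec_eq, vecMulVec_smul, mul_add, mul_one, Matrix.mul_smul, mul_vecMulVec,
        mulVec_mulVec, mul_nonsing_inv _ hu, one_mulVec, neg_smul, sub_eq_add_neg]
    rw [h0, det_mul, det_one_add_replicateCol_mul_replicateRow, smul_dotProduct, he,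
      single_one_dotProduct, smul_eq_mul]
    ring
  rw [hd, div_eq_mul_inv]
  refine mul_le_mul_of_nonneg_left ?_ hA.det_pos.le
  have : 1 / (2 * K) * (A⁻¹ *ᵥ e) i ≤ 1 / (2 * K) * K := by gcongr
  have h3 : 1 / (2 * K) * K = 1 / 2 := by field_simp
  linarith

/-- The exponential factor is absorbed by lowering the precision in one direction; the determinant
at most halves, so the integral grows by at most √2 ≤ 2. All polynomial moments follow from this one
bound. -/
lemma integral_exp_sq_mul_gaussDensity_le {A : Matrix ι ι ℝ} (hA : A.PosDef) {K : ℝ}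
    (hK : 0 < K) {i : ι} (hb : ∀ w : ι → ℝ, w i ^ 2 ≤ K * (w ⬝ᵥ A *ᵥ w)) :
    Integrable (fun w : EuclideanSpace ℝ ι => Real.exp (w i ^ 2 / (4 * K)) * gaussDensity A w) ∧
    ∫ w : EuclideanSpace ℝ ι, Real.exp (w i ^ 2 / (4 * K)) * gaussDensity A w
      ≤ 2 * ∫ w, gaussDensity A w := by
  have hP := posDef_sub_smul_vecMulVec hA hK hb
  have heq : ∀ w : EuclideanSpace ℝ ι, Real.exp (w i ^ 2 / (4 * K)) * gaussDensity A w
      = gaussDensity (A - (1 / (2 * K)) • vecMulVec (Pi.single i 1) (Pi.single i 1)) w := by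
    intro w
    rw [gaussDensity_sub_smul_vecMulVec]
    congr 2
    field_simp
    norm_num
  simp only [heq]
  refine ⟨integrable_gaussDensity hP, ?_⟩
  rw [integral_gaussDensity hP, integral_gaussDensity hA]
  have ha : 0 ≤ √(2 * Real.pi) ^ Fintype.card ι := by positivity
  generalize √(2 * Real.pi) ^ Fintype.card ι = a at *
  rw [div_eq_mul_inv, show 2 * (a / √A.det) = a * (2 / √A.det) by ring]
  refine mul_le_mul_of_nonneg_left ?_ ha
  have hd := hA.det_pos
  have h2 : √A.det / 2
      ≤ √(A - (1 / (2 * K)) • vecMulVec (Pi.single i (1 : ℝ)) (Pi.single i (1 : ℝ))).det := by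
    refine le_trans ?_ (Real.sqrt_le_sqrt (half_det_le_det_sub hA hK hb))
    rw [Real.sqrt_div hd.le]
    refine div_le_div_of_nonneg_left (by positivity) (by positivity) ?_
    rw [Real.sqrt_le_left (by norm_num)]
    norm_num
  calc _ ≤ (√A.det / 2)⁻¹ := inv_anti₀ (by positivity) h2
    _ = _ := by rw [inv_div]

lemma integral_sq_mul_gaussDensity_le {A : Matrix ι ι ℝ} (hA : A.PosDef) {K : ℝ}
    (hK : 0 < K) {i : ι} (hb : ∀ w : ι → ℝ, w i ^ 2 ≤ K * (w ⬝ᵥ A *ᵥ w)) :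
    Integrable (fun w : EuclideanSpace ℝ ι => w i ^ 2 * gaussDensity A w) ∧
    ∫ w : EuclideanSpace ℝ ι, w i ^ 2 * gaussDensity A w ≤ 8 * K * ∫ w, gaussDensity A w := by
  obtain ⟨hI, hle⟩ := integral_exp_sq_mul_gaussDensity_le hA hK hb
  have hpt : ∀ w : EuclideanSpace ℝ ι, w i ^ 2 * gaussDensity A w
      ≤ (4 * K) * (Real.exp (w i ^ 2 / (4 * K)) * gaussDensity A w) := by
    intro w
    rw [← mul_assoc]
    refine mul_le_mul_of_nonneg_right ?_ (gaussDensity_pos A w).le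
    have := Real.add_one_le_exp (w i ^ 2 / (4 * K))
    calc w i ^ 2 = 4 * K * (w i ^ 2 / (4 * K)) := by field_simp
      _ ≤ _ := by gcongr; linarith
  have hint : Integrable (fun w : EuclideanSpace ℝ ι => w i ^ 2 * gaussDensity A w) := by
    refine (hI.const_mul (4 * K)).mono'
      (Continuous.aestronglyMeasurable ?_) (Filter.Eventually.of_forall fun w => ?_)
    · have := continuous_gaussDensity A
      fun_prop
    · rw [Real.norm_of_nonneg (mul_nonneg (sq_nonneg _) (gaussDensity_pos A w).le)]
      exact hpt w
  refine ⟨hint, ?_⟩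
  calc _ ≤ ∫ w, (4 * K) * (Real.exp (w i ^ 2 / (4 * K)) * gaussDensity A w) :=
        integral_mono hint (hI.const_mul _) hpt
    _ ≤ _ := by
        rw [integral_const_mul]
        nlinarith

lemma integral_pow_four_mul_gaussDensity_le {A : Matrix ι ι ℝ} (hA : A.PosDef) {K : ℝ}
    (hK : 0 < K) {i : ι} (hb : ∀ w : ι → ℝ, w i ^ 2 ≤ K * (w ⬝ᵥ A *ᵥ w)) :
    Integrable (fun w : EuclideanSpace ℝ ι => w i ^ 4 * gaussDensity A w) ∧
    ∫ w : EuclideanSpace ℝ ι, w i ^ 4 * gaussDensity A w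
      ≤ 64 * K ^ 2 * ∫ w, gaussDensity A w := by
  obtain ⟨hI, hle⟩ := integral_exp_sq_mul_gaussDensity_le hA hK hb
  -- This is s²/2 ≤ e^s at s = w_i²/(4K), for which w_i⁴ = 32K² · s²/2.
  have hpt : ∀ w : EuclideanSpace ℝ ι, w i ^ 4 * gaussDensity A w
      ≤ (32 * K ^ 2) * (Real.exp (w i ^ 2 / (4 * K)) * gaussDensity A w) := by
    intro w
    rw [← mul_assoc]
    refine mul_le_mul_of_nonneg_right ?_ (gaussDensity_pos A w).le
    have h0 : 0 ≤ w i ^ 2 / (4 * K) := by positivity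
    have := Real.quadratic_le_exp_of_nonneg h0
    calc w i ^ 4 = 32 * K ^ 2 * ((w i ^ 2 / (4 * K)) ^ 2 / 2) := by field_simp; ring
      _ ≤ _ := by gcongr; linarith
  have hint : Integrable (fun w : EuclideanSpace ℝ ι => w i ^ 4 * gaussDensity A w) := by
    refine (hI.const_mul (32 * K ^ 2)).mono'
      (Continuous.aestronglyMeasurable ?_) (Filter.Eventually.of_forall fun w => ?_)
    · have := continuous_gaussDensity A
      fun_prop
    · rw [Real.norm_of_nonneg (mul_nonneg (by positivity) (gaussDensity_pos A w).le)]
      exact hpt w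
  refine ⟨hint, ?_⟩
  calc _ ≤ ∫ w, (32 * K ^ 2) * (Real.exp (w i ^ 2 / (4 * K)) * gaussDensity A w) :=
        integral_mono hint (hI.const_mul _) hpt
    _ ≤ _ := by
        rw [integral_const_mul]
        nlinarith [sq_nonneg K]

lemma abs_pow_three_le {s : ℝ} (hs : 0 < s) (x : ℝ) : |x| ^ 3 ≤ s * x ^ 2 + x ^ 4 / s := by
  rw [← sq_abs x, ← Even.pow_abs (by decide : Even 4) x]
  have ha := abs_nonneg x
  generalize |x| = a at *
  have h : s * a ^ 2 + a ^ 4 / s - a ^ 3 = a ^ 2 / s * ((s - a / 2) ^ 2 + 3 / 4 * a ^ 2) := by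
    field_simp; ring
  have : 0 ≤ a ^ 2 / s * ((s - a / 2) ^ 2 + 3 / 4 * a ^ 2) := by positivity
  linarith

/-- Comparison of two Gaussian normalizations by Jensen's inequality. -/
lemma integral_gaussDensity_le_of_le_add {A A' : Matrix ι ι ℝ} (hA : A.PosDef) (hA' : A'.PosDef)
    {c K : ℝ} (hc : 0 ≤ c) (hK : 0 < K)
    (hle : ∀ w : ι → ℝ, w ⬝ᵥ A *ᵥ w ≤ w ⬝ᵥ A' *ᵥ w + c * ∑ i, w i ^ 2)
    (hb : ∀ i, ∀ w : ι → ℝ, w i ^ 2 ≤ K * (w ⬝ᵥ A' *ᵥ w)) :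
    ∫ w, gaussDensity A' w
      ≤ Real.exp (4 * c * K * Fintype.card ι) * ∫ w, gaussDensity A w := by
  set M : ℝ := 4 * c * K * Fintype.card ι with hM
  have hI' := integrable_gaussDensity hA'
  have hS : Integrable (fun w : EuclideanSpace ℝ ι => (∑ i, w i ^ 2) * gaussDensity A' w) := by
    simp only [Finset.sum_mul]
    exact integrable_finsetSum _ fun i _ => (integral_sq_mul_gaussDensity_le hA' hK (hb i)).1
  have hSle : ∫ w : EuclideanSpace ℝ ι, (∑ i, w i ^ 2) * gaussDensity A' w
      ≤ Fintype.card ι * (8 * K * ∫ w, gaussDensity A' w) := by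
    simp only [Finset.sum_mul]
    rw [integral_finsetSum _ fun i _ => (integral_sq_mul_gaussDensity_le hA' hK (hb i)).1]
    refine (Finset.sum_le_card_nsmul _ _ _ fun i _ =>
      (integral_sq_mul_gaussDensity_le hA' hK (hb i)).2).trans ?_
    rw [nsmul_eq_mul, Finset.card_univ]
  -- Jensen in tangent-line form: e^y ≥ 1 + y at y = M - (c/2)∑ w_i². Here M is the upper bound
  -- (c/2) · card · 8K for the mean of (c/2)∑ w_i² under A'.
  have hpt : ∀ w : EuclideanSpace ℝ ι,
      Real.exp (-M) * ((1 + M) * gaussDensity A' w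
        - c / 2 * ((∑ i, w i ^ 2) * gaussDensity A' w)) ≤ gaussDensity A w := by
    intro w
    have h1 : Real.exp (-(c / 2 * ∑ i, w i ^ 2)) * gaussDensity A' w ≤ gaussDensity A w := by
      rw [gaussDensity, gaussDensity, ← Real.exp_add]
      refine Real.exp_le_exp.2 ?_
      have := hle w.ofLp
      linarith
    refine le_trans ?_ h1
    have h2 := Real.add_one_le_exp (M - c / 2 * ∑ i, w i ^ 2)
    have h3 : Real.exp (-(c / 2 * ∑ i, w i ^ 2))
        = Real.exp (-M) * Real.exp (M - c / 2 * ∑ i, w i ^ 2) := by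
      rw [← Real.exp_add]; congr 1; ring
    rw [h3, mul_assoc]
    refine mul_le_mul_of_nonneg_left ?_ (Real.exp_pos _).le
    have := mul_le_mul_of_nonneg_right h2 (gaussDensity_pos A' w).le
    linarith
  have hint : Integrable fun w : EuclideanSpace ℝ ι => Real.exp (-M) * ((1 + M) * gaussDensity A' w
        - c / 2 * ((∑ i, w i ^ 2) * gaussDensity A' w)) :=
    ((hI'.const_mul _).sub (hS.const_mul _)).const_mul _
  have h := integral_mono hint (integrable_gaussDensity hA) hpt
  rw [integral_const_mul, integral_sub (hI'.const_mul _) (hS.const_mul _), integral_const_mul,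
    integral_const_mul] at h
  have h4 : ∫ w, gaussDensity A' w ≤ (1 + M) * (∫ w, gaussDensity A' w)
      - c / 2 * ∫ w : EuclideanSpace ℝ ι, (∑ i, w i ^ 2) * gaussDensity A' w := by
    have := mul_le_mul_of_nonneg_left hSle (by positivity : 0 ≤ c / 2)
    rw [hM]
    linarith
  calc ∫ w, gaussDensity A' w = Real.exp M * (Real.exp (-M) * ∫ w, gaussDensity A' w) := by
        rw [← mul_assoc, ← Real.exp_add]; simp
    _ ≤ _ := by
        refine mul_le_mul_of_nonneg_left (le_trans ?_ h) (Real.exp_pos _).le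
        exact mul_le_mul_of_nonneg_left h4 (Real.exp_pos _).le

end Gaussian

/-! ### Sobolev and Wirtinger inequalities on the discrete circle -/

section Discrete

variable {N : ℕ}

lemma abs_sub_shift_le (w : ZMod N → ℝ) (i : ZMod N) (n : ℕ) :
    |w i - w (i + n)| ≤ ∑ k ∈ Finset.range n, |w (i + k) - w (i + k + 1)| := by
  induction n with
  | zero => simp
  | succ n ih =>
    rw [Finset.sum_range_succ]
    have h : w i - w (i + (n + 1 : ℕ)) = (w i - w (i + n)) + (w (i + n) - w (i + n + 1)) := by
      push_cast
      rw [add_assoc]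
      ring
    rw [h]
    exact (abs_add_le _ _).trans (by linarith)

variable [NeZero N]

lemma abs_sub_le_sum (w : ZMod N → ℝ) (i j : ZMod N) :
    |w i - w j| ≤ ∑ k, |w k - w (k + 1)| := by
  have h := abs_sub_shift_le w i (j - i).val
  -- The path from i to j takes fewer than N steps, so it uses each edge of the circle at most once.
  rw [ZMod.natCast_zmod_val, add_sub_cancel] at h
  refine h.trans ?_
  have hinj : Set.InjOn (fun k : ℕ => i + (k : ZMod N)) (Finset.range (j - i).val) := by
    intro a ha b hb hab
    have ha' := (Finset.mem_range.1 ha).trans (ZMod.val_lt (j - i))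
    have hb' := (Finset.mem_range.1 hb).trans (ZMod.val_lt (j - i))
    have := congrArg ZMod.val (add_left_cancel hab)
    rwa [ZMod.val_cast_of_lt ha', ZMod.val_cast_of_lt hb'] at this
  rw [← Finset.sum_image (f := fun k : ZMod N => |w k - w (k + 1)|) hinj]
  exact Finset.sum_le_sum_of_subset_of_nonneg (Finset.subset_univ _) fun _ _ _ => abs_nonneg _

/-- A discrete Sobolev inequality on the circle. -/
lemma sq_le_sum_sq_add (w : ZMod N → ℝ) (i : ZMod N) :
    w i ^ 2 ≤ 2 / N * ∑ j, w j ^ 2 + 2 * N * ∑ j, (w j - w (j + 1)) ^ 2 := by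
  have hN : (0 : ℝ) < N := Nat.cast_pos.2 (NeZero.pos N)
  set S := ∑ j, (w j - w (j + 1)) ^ 2 with hS
  have h1 : ∀ j, w i ^ 2 ≤ 2 * w j ^ 2 + 2 * (N * S) := by
    intro j
    have h2 : (w i - w j) ^ 2 ≤ N * S := by
      calc (w i - w j) ^ 2 = |w i - w j| ^ 2 := (sq_abs _).symm
        _ ≤ (∑ k, |w k - w (k + 1)|) ^ 2 := by
          gcongr
          exact abs_sub_le_sum w i j
        _ ≤ (Finset.univ : Finset (ZMod N)).card * ∑ k, |w k - w (k + 1)| ^ 2 :=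
          sq_sum_le_card_mul_sum_sq
        _ = N * S := by simp [hS, ZMod.card]
    nlinarith [sq_nonneg (w i - 2 * w j)]
  have h3 := Finset.sum_le_sum fun j (_ : j ∈ Finset.univ) => h1 j
  rw [Finset.sum_add_distrib, ← Finset.mul_sum] at h3
  simp only [Finset.sum_const, Finset.card_univ, ZMod.card, nsmul_eq_mul] at h3
  rw [← mul_le_mul_iff_right₀ hN]
  refine h3.trans (le_of_eq ?_)
  field_simp

-- Parseval, obtained from the inversion formula `dft_dft`.
open ZMod in
lemma sum_norm_sq_dft (Φ : ZMod N → ℂ) :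
    ∑ k, ‖dft Φ k‖ ^ 2 = N * ∑ j, ‖Φ j‖ ^ 2 := by
  have hconj : ∀ k, (starRingEnd ℂ) (dft Φ k) = ∑ j, stdAddChar (j * k) * (starRingEnd ℂ) (Φ j) := by
    intro k
    rw [dft_apply, map_sum]
    refine Finset.sum_congr rfl fun j _ => ?_
    rw [smul_eq_mul, map_mul, ← AddChar.map_neg_eq_conj, neg_neg]
  have h : ∑ k, dft Φ k * (starRingEnd ℂ) (dft Φ k) = N * ∑ j, Φ j * (starRingEnd ℂ) (Φ j) := by
    simp only [hconj, Finset.mul_sum]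
    rw [Finset.sum_comm]
    refine Finset.sum_congr rfl fun j _ => ?_
    have h1 : ∑ k, stdAddChar (j * k) * dft Φ k = N * Φ j := by
      have := congrFun (dft_dft Φ) (-j)
      rw [dft_apply] at this
      simpa [mul_comm] using this
    calc _ = (∑ k, stdAddChar (j * k) * dft Φ k) * (starRingEnd ℂ) (Φ j) := by
          rw [Finset.sum_mul]
          exact Finset.sum_congr rfl fun k _ => by ring
      _ = _ := by rw [h1]; ring
  simp only [Complex.mul_conj, Complex.normSq_eq_norm_sq] at h
  exact_mod_cast h

open ZMod in
lemma dft_sub_shift (Φ : ZMod N → ℂ) (k : ZMod N) :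
    dft (fun j => Φ j - Φ (j + 1)) k = (1 - stdAddChar k) * dft Φ k := by
  have h : ∑ j, stdAddChar (-(j * k)) * Φ (j + 1)
      = stdAddChar k * ∑ j, stdAddChar (-(j * k)) * Φ j := by
    rw [← Equiv.sum_comp (Equiv.addRight (1 : ZMod N)) fun j => stdAddChar (-(j * k)) * Φ j,
      Finset.mul_sum]
    refine Finset.sum_congr rfl fun j _ => ?_
    rw [← mul_assoc, ← AddChar.map_add_eq_mul]
    congr 2
    simp only [Equiv.coe_addRight]
    ring
  simp only [dft_apply, smul_eq_mul, mul_sub, Finset.sum_sub_distrib, h]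
  ring

open ZMod in
lemma norm_one_sub_stdAddChar_sq (k : ZMod N) :
    ‖(1 : ℂ) - stdAddChar k‖ ^ 2 = 4 * Real.sin (Real.pi * k.val / N) ^ 2 := by
  have h : stdAddChar k = Complex.exp (((2 * (Real.pi * k.val / N) : ℝ) : ℂ) * Complex.I) := by
    rw [stdAddChar_apply, toCircle_apply]
    congr 1
    push_cast
    ring
  set θ := Real.pi * k.val / N
  rw [h, ← Complex.normSq_eq_norm_sq, Complex.normSq_apply]
  simp only [Complex.sub_re, Complex.sub_im, Complex.one_re, Complex.one_im,
    Complex.exp_ofReal_mul_I_re, Complex.exp_ofReal_mul_I_im, Real.cos_two_mul, Real.sin_two_mul]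
  nlinarith [Real.sin_sq_add_cos_sq θ]

/-- The angle πk/N lies between π/N and π - π/N; beyond π/2 it is reflected. -/
lemma sin_sq_le_sin_sq {k : ZMod N} (hk : k ≠ 0) :
    Real.sin (Real.pi / N) ^ 2 ≤ Real.sin (Real.pi * k.val / N) ^ 2 := by
  have hN : (0 : ℝ) < N := Nat.cast_pos.2 (NeZero.pos N)
  have h1 : 1 ≤ k.val := Nat.one_le_iff_ne_zero.2 fun h => hk ((ZMod.val_eq_zero k).1 h)
  have h2 : k.val + 1 ≤ N := ZMod.val_lt k
  have h1' : (1 : ℝ) ≤ k.val := by exact_mod_cast h1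
  have h2' : (k.val : ℝ) + 1 ≤ N := by exact_mod_cast h2
  have hpi := Real.pi_pos
  have h0 : 0 ≤ Real.sin (Real.pi / N) := by
    refine Real.sin_nonneg_of_nonneg_of_le_pi (by positivity) (div_le_self hpi.le ?_)
    linarith
  refine pow_le_pow_left₀ h0 ?_ 2
  rcases le_total (Real.pi * k.val / N) (Real.pi / 2) with hc | hc
  · refine Real.sin_le_sin_of_le_of_le_pi_div_two ?_ hc ?_
    · have : 0 < Real.pi / N := by positivity
      linarith
    · rw [div_le_div_iff_of_pos_right hN]
      nlinarith
  · rw [← Real.sin_pi_sub (Real.pi * k.val / N)]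
    refine Real.sin_le_sin_of_le_of_le_pi_div_two ?_ (by linarith) ?_
    · have : 0 < Real.pi / N := by positivity
      linarith
    · rw [le_sub_iff_add_le, ← add_div, div_le_iff₀ hN]
      nlinarith

/-- The discrete Wirtinger inequality on the circle, with the sharp constant. -/
lemma wirtinger (v : ZMod N → ℝ) (hv : ∑ j, v j = 0) :
    4 * Real.sin (Real.pi / N) ^ 2 * ∑ j, v j ^ 2 ≤ ∑ j, (v j - v (j + 1)) ^ 2 := by
  have hN : (0 : ℝ) < N := Nat.cast_pos.2 (NeZero.pos N)
  set Φ : ZMod N → ℂ := fun j => (v j : ℂ) with hΦ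
  have e1 := sum_norm_sq_dft Φ
  have e2 := sum_norm_sq_dft fun j => Φ j - Φ (j + 1)
  -- The zero mode, the only one killed by the difference operator, is absent; on the others the
  -- multiplier is at least 4 sin²(π/N).
  have h0 : ZMod.dft Φ 0 = 0 := by
    rw [ZMod.dft_apply_zero]
    simp only [hΦ]
    exact_mod_cast congrArg (fun x : ℝ => (x : ℂ)) hv
  have hle : 4 * Real.sin (Real.pi / N) ^ 2 * ∑ k, ‖ZMod.dft Φ k‖ ^ 2
      ≤ ∑ k, ‖ZMod.dft (fun j => Φ j - Φ (j + 1)) k‖ ^ 2 := by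
    rw [Finset.mul_sum]
    refine Finset.sum_le_sum fun k _ => ?_
    rw [dft_sub_shift, norm_mul, mul_pow, norm_one_sub_stdAddChar_sq]
    by_cases hk : k = 0
    · simp [hk, h0]
    · have := sin_sq_le_sin_sq hk
      gcongr
  rw [e1, e2] at hle
  have n1 : ∀ j, ‖Φ j‖ ^ 2 = v j ^ 2 := fun j => by simp [hΦ]
  have n2 : ∀ j, ‖Φ j - Φ (j + 1)‖ ^ 2 = (v j - v (j + 1)) ^ 2 := fun j => by
    simp only [hΦ, ← Complex.ofReal_sub, Complex.norm_real, Real.norm_eq_abs, sq_abs]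
  simp only [n1, n2] at hle
  rw [← mul_le_mul_iff_right₀ hN]
  linarith

end Discrete

/-! ### Minimization of convex functions in a Hilbert space -/

section Minimization

open Filter Topology

/-- A nonnegative continuous convex function on a closed convex subset of a Hilbert space attains
its infimum as soon as its sublevel sets are bounded. -/
lemma exists_forall_le_of_convexOn {H : Type*} [NormedAddCommGroup H] [InnerProductSpace ℝ H]
    [CompleteSpace H] {K : Set H} (hne : K.Nonempty) (hcl : IsClosed K) (hcv : Convex ℝ K)
    {f : H → ℝ} (hf : Continuous f) (hfc : ConvexOn ℝ univ f) (hf0 : ∀ x, 0 ≤ f x)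
    (hbd : ∀ c, ∃ R, ∀ x ∈ K, f x ≤ c → ‖x‖ ≤ R) :
    ∃ x ∈ K, ∀ y ∈ K, f x ≤ f y := by
  set m := sInf (f '' K) with hm
  have hbb : BddBelow (f '' K) := ⟨0, by rintro _ ⟨x, -, rfl⟩; exact hf0 x⟩
  have hmle : ∀ y ∈ K, m ≤ f y := fun y hy => csInf_le hbb ⟨y, hy, rfl⟩
  let L : ℕ → Set H := fun n => K ∩ {x | f x ≤ m + 1 / ((n : ℝ) + 1)}
  have hLcl : ∀ n, IsClosed (L n) := fun n => hcl.inter (isClosed_le hf continuous_const)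
  have hLcv : ∀ n, Convex ℝ (L n) := fun n => by
    have := hfc.convex_le (m + 1 / ((n : ℝ) + 1))
    simp only [mem_univ, true_and] at this
    exact hcv.inter this
  have hLne : ∀ n, (L n).Nonempty := fun n => by
    have hpos : (0 : ℝ) < 1 / ((n : ℝ) + 1) := by positivity
    obtain ⟨_, ⟨x, hx, rfl⟩, hlt⟩ := exists_lt_of_csInf_lt (hne.image f)
      (show sInf (f '' K) < m + 1 / ((n : ℝ) + 1) by linarith)
    exact ⟨x, hx, hlt.le⟩
  have hLanti : ∀ {n k : ℕ}, n ≤ k → L k ⊆ L n := fun {n k} hnk x hx =>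
    ⟨hx.1, le_trans (b := m + 1 / ((k : ℝ) + 1)) hx.2 (by gcongr)⟩
  -- Weak compactness is avoided: in the nested sublevel sets the points of least norm have
  -- increasing bounded norms, and the parallelogram law then makes them Cauchy.
  have hmin : ∀ n, ∃ x ∈ L n, ∀ y ∈ L n, ‖x‖ ≤ ‖y‖ := fun n => by
    obtain ⟨x, hx, hxe⟩ := exists_norm_eq_iInf_of_complete_convex (hLne n)
      (hLcl n).isComplete (hLcv n) (0 : H)
    refine ⟨x, hx, fun y hy => ?_⟩
    have hb : BddBelow (range fun w : L n => ‖(0 : H) - w‖) :=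
      ⟨0, by rintro _ ⟨w, rfl⟩; exact norm_nonneg _⟩
    have := ciInf_le hb ⟨y, hy⟩
    rw [← hxe] at this
    simpa using this
  choose x hxL hxmin using hmin
  have hmono : Monotone fun n => ‖x n‖ ^ 2 := fun n k hnk =>
    pow_le_pow_left₀ (norm_nonneg _) (hxmin n _ (hLanti hnk (hxL k))) 2
  obtain ⟨R, hR⟩ := hbd (m + 1)
  have hxR : ∀ n, ‖x n‖ ≤ R := fun n => hR _ (hxL n).1 <| (hxL n).2.trans <| by
    have : 1 / ((n : ℝ) + 1) ≤ 1 := by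
      rw [div_le_one (by positivity)]
      linarith [n.cast_nonneg (α := ℝ)]
    linarith
  have hbdd : BddAbove (range fun n => ‖x n‖ ^ 2) :=
    ⟨R ^ 2, by rintro _ ⟨n, rfl⟩; exact pow_le_pow_left₀ (norm_nonneg _) (hxR n) 2⟩
  have hlim := tendsto_atTop_ciSup hmono hbdd
  have hpar : ∀ n k, n ≤ k → ‖x n - x k‖ ^ 2 ≤ 2 * (‖x k‖ ^ 2 - ‖x n‖ ^ 2) := by
    intro n k hnk
    have hmid : (1 / 2 : ℝ) • x n + (1 / 2 : ℝ) • x k ∈ L n :=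
      hLcv n (hxL n) (hLanti hnk (hxL k)) (by norm_num) (by norm_num) (by norm_num)
    have h1 := hxmin n _ hmid
    rw [← smul_add, norm_smul, Real.norm_of_nonneg (by norm_num)] at h1
    have h2 : (2 * ‖x n‖) ^ 2 ≤ ‖x n + x k‖ ^ 2 :=
      pow_le_pow_left₀ (by positivity) (by linarith) 2
    have h3 := parallelogram_law_with_norm ℝ (x n) (x k)
    nlinarith
  have hcau : CauchySeq x := by
    rw [Metric.cauchySeq_iff']
    intro δ hδ
    have hc := Metric.cauchySeq_iff'.1 hlim.cauchySeq (δ ^ 2 / 2) (by positivity)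
    obtain ⟨n, hn⟩ := hc
    refine ⟨n, fun k hk => ?_⟩
    have h1 := hn k hk
    rw [Real.dist_eq] at h1
    have h2 := hpar n k hk
    have h3 := le_abs_self (‖x k‖ ^ 2 - ‖x n‖ ^ 2)
    rw [dist_comm, dist_eq_norm]
    exact lt_of_pow_lt_pow_left₀ 2 hδ.le (by linarith)
  obtain ⟨z, hz⟩ := cauchySeq_tendsto_of_complete hcau
  have hzL : ∀ n, z ∈ L n := fun n =>
    (hLcl n).mem_of_tendsto hz (eventually_atTop.2 ⟨n, fun k hk => hLanti hk (hxL k)⟩)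
  refine ⟨z, (hzL 0).1, fun y hy => le_trans ?_ (hmle y hy)⟩
  have hl : Tendsto (fun n : ℕ => m + 1 / ((n : ℝ) + 1)) atTop (𝓝 m) := by
    simpa using (tendsto_one_div_add_atTop_nhds_zero_nat (𝕜 := ℝ)).const_add m
  exact ge_of_tendsto' hl fun n => (hzL n).2

end Minimization

/-! ### Weak gradients -/

section WeakGradient

open Filter Topology

variable {N : ℕ} [NeZero N]

lemma continuous_gradient {φ : Conf N → ℝ} (hφ : ContDiff ℝ 1 φ) : Continuous (gradient φ) :=
  (InnerProductSpace.toDual ℝ (Conf N)).symm.continuous.comp (hφ.continuous_fderiv one_ne_zero)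

lemma support_gradient_subset (φ : Conf N → ℝ) : Function.support (gradient φ) ⊆ tsupport φ := by
  intro x hx
  refine support_fderiv_subset ℝ (fun h => hx ?_)
  simp [gradient, h]

lemma hasCompactSupport_gradient {φ : Conf N → ℝ} (hφ : HasCompactSupport φ) :
    HasCompactSupport (gradient φ) :=
  hφ.mono' (support_gradient_subset φ)

lemma integral_gradient_eq_zero {φ : Conf N → ℝ} (hφ : ContDiff ℝ 1 φ)
    (hc : HasCompactSupport φ) : ∫ x, gradient φ x = 0 := by
  refine integral_eq_zero_of_forall_integral_inner_eq_zero ℝ _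
    ((continuous_gradient hφ).integrable_of_hasCompactSupport (hasCompactSupport_gradient hc))
    fun v => ?_
  have hcont : Continuous fun x => fderiv ℝ φ x v :=
    (hφ.continuous_fderiv one_ne_zero).clm_apply continuous_const
  have hint : Integrable fun x => fderiv ℝ φ x v :=
    hcont.integrable_of_hasCompactSupport (hc.fderiv_apply ℝ v)
  have h := integral_mul_fderiv_eq_neg_fderiv_mul_of_integrable (μ := volume)
    (f := fun _ : Conf N => (1 : ℝ)) (g := φ) (v := v) (by simp) (by simpa using hint)
    (by simpa using hφ.continuous.integrable_of_hasCompactSupport hc)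
    (fun _ _ => differentiableAt_const _)
    (fun x _ => (hφ.differentiable one_ne_zero).differentiableAt)
  simp only [inner_gradient_right]
  simpa using h

lemma gradient_mul {f g : Conf N → ℝ} (hf : ContDiff ℝ 1 f) (hg : ContDiff ℝ 1 g) (x : Conf N) :
    gradient (fun y => f y * g y) x = f x • gradient g x + g x • gradient f x := by
  simp only [gradient]
  rw [fderiv_fun_mul (hf.differentiable one_ne_zero).differentiableAt
    (hg.differentiable one_ne_zero).differentiableAt, map_add, map_smul, map_smul]

lemma hasWeakGradient_of_contDiff {h : Conf N → ℝ} (hh : ContDiff ℝ 1 h) :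
    HasWeakGradient h (gradient h) where
  locallyIntegrable := hh.continuous.locallyIntegrable
  locallyIntegrable_grad := (continuous_gradient hh).locallyIntegrable
  integral_eq φ hφ hc := by
    have hφ1 : ContDiff ℝ 1 φ := hφ.of_le (by exact_mod_cast le_top)
    have h0 := integral_gradient_eq_zero (hh.mul hφ1) (hc.mul_left (f := h))
    simp only [gradient_mul hh hφ1] at h0
    rw [integral_add] at h0
    · exact eq_neg_of_add_eq_zero_left h0
    · exact (hh.continuous.smul (continuous_gradient hφ1)).integrable_of_hasCompactSupport
        ((hasCompactSupport_gradient hc).smul_left (f := h))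
    · exact (hφ.continuous.smul (continuous_gradient hh)).integrable_of_hasCompactSupport
        (hc.smul_right (f' := gradient h))

namespace HasWeakGradient

variable {h h₁ h₂ : Conf N → ℝ} {g g₁ g₂ : Conf N → Conf N}

/-- A test function supported in A sees h as a constant, and the gradient of a test function has
integral zero. -/
lemma ae_eq_zero_of_eqOn_const (H : HasWeakGradient h g) {A : Set (Conf N)} (hA : IsOpen A)
    {c : ℝ} (hc : ∀ x ∈ A, h x = c) : ∀ᵐ x, x ∈ A → g x = 0 := by
  refine hA.ae_eq_zero_of_integral_contDiff_smul_eq_zero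
    (H.locallyIntegrable_grad.locallyIntegrableOn A) fun φ hφ hφc hφA => ?_
  have hφ1 : ContDiff ℝ 1 φ := hφ.of_le (by exact_mod_cast le_top)
  have h1 := H.integral_eq φ hφ hφc
  have h2 : (fun x => h x • gradient φ x) = fun x => c • gradient φ x := by
    funext x
    by_cases hx : x ∈ A
    · rw [hc x hx]
    · have : gradient φ x = 0 := by
        by_contra h0
        exact hx (hφA (support_gradient_subset φ h0))
      simp [this]
  rw [h2, integral_smul, integral_gradient_eq_zero hφ1 hφc, smul_zero] at h1
  exact neg_eq_zero.1 h1.symm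

lemma congr_ae (H : HasWeakGradient h₁ g₁) (hh : h₁ =ᵐ[volume] h₂) (hg : g₁ =ᵐ[volume] g₂) :
    HasWeakGradient h₂ g₂ where
  locallyIntegrable := H.locallyIntegrable.congr hh
  locallyIntegrable_grad := H.locallyIntegrable_grad.congr hg
  integral_eq φ hφ hc := by
    have e1 : ∫ x, h₂ x • gradient φ x = ∫ x, h₁ x • gradient φ x :=
      integral_congr_ae (hh.mono fun x hx => by simp only [hx])
    have e2 : ∫ x, φ x • g₂ x = ∫ x, φ x • g₁ x :=
      integral_congr_ae (hg.mono fun x hx => by simp only [hx])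
    rw [e1, e2]
    exact H.integral_eq φ hφ hc

lemma linear_combination (H₁ : HasWeakGradient h₁ g₁) (H₂ : HasWeakGradient h₂ g₂) (a b : ℝ) :
    HasWeakGradient (a • h₁ + b • h₂) (a • g₁ + b • g₂) where
  locallyIntegrable := (H₁.locallyIntegrable.smul a).add (H₂.locallyIntegrable.smul b)
  locallyIntegrable_grad :=
    (H₁.locallyIntegrable_grad.smul a).add (H₂.locallyIntegrable_grad.smul b)
  integral_eq φ hφ hc := by
    have hφ1 : ContDiff ℝ 1 φ := hφ.of_le (by exact_mod_cast le_top)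
    have i1 := fun {h : Conf N → ℝ} (hh : LocallyIntegrable h volume) =>
      hh.integrable_smul_right_of_hasCompactSupport (continuous_gradient hφ1)
        (hasCompactSupport_gradient hc)
    have i2 := fun {g : Conf N → Conf N} (hg : LocallyIntegrable g volume) =>
      hg.integrable_smul_left_of_hasCompactSupport hφ.continuous hc
    have e1 : ∀ x, (a • h₁ + b • h₂) x • gradient φ x
        = a • (h₁ x • gradient φ x) + b • (h₂ x • gradient φ x) := fun x => by
      simp only [Pi.add_apply, Pi.smul_apply, add_smul, smul_assoc]
    have e2 : ∀ x, φ x • (a • g₁ + b • g₂) x = a • (φ x • g₁ x) + b • (φ x • g₂ x) := fun x => by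
      simp only [Pi.add_apply, Pi.smul_apply, smul_add, smul_comm (φ x)]
    simp only [e1, e2]
    rw [integral_add ((i1 H₁.locallyIntegrable).fun_smul a) ((i1 H₂.locallyIntegrable).fun_smul b),
      integral_add ((i2 H₁.locallyIntegrable_grad).fun_smul a)
        ((i2 H₂.locallyIntegrable_grad).fun_smul b), integral_smul, integral_smul, integral_smul,
      integral_smul, H₁.integral_eq φ hφ hc, H₂.integral_eq φ hφ hc]
    simp only [smul_neg, neg_add]

end HasWeakGradient

end WeakGradient

/-! ### The Gibbs measure and its L² spaces -/

section Gibbs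

open Filter Topology

variable {N : ℕ} [NeZero N] {V : Conf N → ℝ} {ε : ℝ}

lemma measurable_gibbs_density (hV : Continuous V) (ε : ℝ) :
    Measurable fun x : Conf N => ENNReal.ofReal (Real.exp (-V x / ε)) :=
  (Continuous.measurable (by fun_prop)).ennreal_ofReal

lemma volume_absolutelyContinuous_gibbs (hV : Continuous V) (ε : ℝ) :
    (volume : Measure (Conf N)) ≪ gibbs V ε :=
  withDensity_absolutelyContinuous' (measurable_gibbs_density hV ε).aemeasurable
    (Eventually.of_forall fun _ => by simp [Real.exp_pos])

lemma integral_gibbs {E : Type*} [NormedAddCommGroup E] [NormedSpace ℝ E]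
    (hV : Continuous V) (ε : ℝ) (f : Conf N → E) :
    ∫ x, f x ∂gibbs V ε = ∫ x, Real.exp (-V x / ε) • f x := by
  rw [gibbs, integral_withDensity_eq_integral_toReal_smul (measurable_gibbs_density hV ε)
    (Eventually.of_forall fun _ => ENNReal.ofReal_lt_top)]
  simp only [ENNReal.toReal_ofReal (Real.exp_pos _).le]

lemma integrable_gibbs_iff {E : Type*} [NormedAddCommGroup E] [NormedSpace ℝ E]
    (hV : Continuous V) (ε : ℝ) {f : Conf N → E} :
    Integrable f (gibbs V ε) ↔ Integrable fun x => Real.exp (-V x / ε) • f x := by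
  rw [gibbs, integrable_withDensity_iff_integrable_smul' (measurable_gibbs_density hV ε)
    (Eventually.of_forall fun _ => ENNReal.ofReal_lt_top)]
  simp only [ENNReal.toReal_ofReal (Real.exp_pos _).le]

lemma isFiniteMeasure_gibbs (hI : Integrable fun x : Conf N => Real.exp (-V x / ε)) :
    IsFiniteMeasure (gibbs V ε) :=
  isFiniteMeasure_withDensity_ofReal hI.2

lemma locallyIntegrable_of_memLp_gibbs {E : Type*} [NormedAddCommGroup E] [NormedSpace ℝ E]
    (hV : Continuous V) [IsFiniteMeasure (gibbs V ε)] {f : Conf N → E}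
    (hf : MemLp f 2 (gibbs V ε)) : LocallyIntegrable f := by
  have h1 := ((integrable_gibbs_iff hV ε).1 (hf.integrable (by norm_num))).locallyIntegrable
  have h2 := h1.continuous_smul (g := fun x => Real.exp (V x / ε)) (by fun_prop)
  refine h2.congr (Eventually.of_forall fun x => ?_)
  simp only [smul_smul, ← Real.exp_add, neg_div]
  simp

/-- Integration against a bounded kernel is continuous on `L²` of a finite measure. -/
lemma tendsto_integral_of_tendsto_Lp {α E F : Type*} [MeasurableSpace α] {ν : Measure α}
    [IsFiniteMeasure ν] [NormedAddCommGroup E] [NormedAddCommGroup F] [NormedSpace ℝ F]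
    {u : ℕ → Lp E 2 ν} {v : Lp E 2 ν} (huv : Tendsto u atTop (𝓝 v)) {T : α → E → F} {C : ℝ}
    (hT : ∀ x a b, ‖T x a - T x b‖ ≤ C * ‖a - b‖) (hT0 : ∀ x, T x 0 = 0)
    (hm : ∀ w : Lp E 2 ν, AEStronglyMeasurable (fun x => T x (w x)) ν) :
    Tendsto (fun n => ∫ x, T x (u n x) ∂ν) atTop (𝓝 (∫ x, T x (v x) ∂ν)) := by
  have hint : ∀ w : Lp E 2 ν, Integrable (fun x => T x (w x)) ν := fun w => by
    have hw : Integrable w ν := (Lp.memLp w).integrable (by norm_num)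
    refine (hw.norm.const_mul C).mono' (hm w) (Eventually.of_forall fun x => ?_)
    simpa [hT0] using hT x (w x) 0
  refine tendsto_integral_of_L1' _ (hm v) (Eventually.of_forall fun n => hint (u n)) ?_
  have hc : ν univ ^ (1 / (1 : ENNReal).toReal - 1 / (2 : ENNReal).toReal) ≠ ⊤ :=
    ENNReal.rpow_ne_top_of_nonneg (by norm_num) (measure_ne_top _ _)
  have hlim := ((Lp.tendsto_Lp_iff_tendsto_eLpNorm' u v).1 huv)
  have hlim2 := ENNReal.Tendsto.const_mul (a := ENNReal.ofReal C)
    (ENNReal.Tendsto.mul_const hlim (Or.inr hc)) (Or.inr ENNReal.ofReal_ne_top)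
  rw [zero_mul, mul_zero] at hlim2
  refine tendsto_of_tendsto_of_tendsto_of_le_of_le tendsto_const_nhds hlim2
    (fun _ => bot_le) fun n => ?_
  refine (eLpNorm_le_mul_eLpNorm_of_ae_le_mul
    (Eventually.of_forall fun x => hT x (u n x) (v x)) 1).trans ?_
  gcongr
  exact eLpNorm_le_eLpNorm_mul_rpow_measure_univ (by norm_num)
    ((Lp.aestronglyMeasurable _).sub (Lp.aestronglyMeasurable _))

end Gibbs

/-! ### Existence of the equilibrium potential -/

section Existence

open Filter Topology

variable {N : ℕ}

/-- The values allowed at `x` for a function with values in `[0,1]`, equal to `1` on `A` and to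
`0` on `D`. -/
def allowedValues (A D : Set (Conf N)) (x : Conf N) : Set ℝ :=
  {t | t ∈ Icc (0 : ℝ) 1 ∧ (x ∈ A → t = 1) ∧ (x ∈ D → t = 0)}

lemma isClosed_allowedValues (A D : Set (Conf N)) (x : Conf N) :
    IsClosed (allowedValues A D x) := by
  have h : ∀ (S : Set (Conf N)) (c : ℝ), IsClosed {t : ℝ | x ∈ S → t = c} := fun S c => by
    by_cases hx : x ∈ S
    · simp [hx]
    · simp [hx]
  exact isClosed_Icc.inter ((h A 1).inter (h D 0))

lemma convex_allowedValues (A D : Set (Conf N)) (x : Conf N) :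
    Convex ℝ (allowedValues A D x) := by
  intro s hs t ht a b ha hb hab
  refine ⟨convex_Icc 0 1 hs.1 ht.1 ha hb hab, fun hx => ?_, fun hx => ?_⟩
  · simp [hs.2.1 hx, ht.2.1 hx, hab]
  · simp [hs.2.2 hx, ht.2.2 hx]

variable [NeZero N] {V : Conf N → ℝ} {ε : ℝ} {A D : Set (Conf N)}

/-- The weighted Sobolev pairs `(h, ∇h)` of the class `𝓗`, up to null sets. -/
def admissiblePairs (V : Conf N → ℝ) (ε : ℝ) (A D : Set (Conf N)) :
    Set (WithLp 2 (Lp ℝ 2 (gibbs V ε) × Lp (Conf N) 2 (gibbs V ε))) :=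
  {p | HasWeakGradient p.fst p.snd ∧ ∀ᵐ x ∂gibbs V ε, p.fst x ∈ allowedValues A D x}

lemma convex_admissiblePairs (hV : Continuous V) : Convex ℝ (admissiblePairs V ε A D) := by
  rintro p ⟨hp, hp'⟩ q ⟨hq, hq'⟩ a b ha hb hab
  have e1 : ((a • p + b • q).fst : Conf N → ℝ)
      =ᵐ[gibbs V ε] a • (p.fst : Conf N → ℝ) + b • (q.fst : Conf N → ℝ) :=
    (Lp.coeFn_add _ _).trans ((Lp.coeFn_smul a p.fst).add (Lp.coeFn_smul b q.fst))
  have e2 : ((a • p + b • q).snd : Conf N → Conf N)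
      =ᵐ[gibbs V ε] a • (p.snd : Conf N → Conf N) + b • (q.snd : Conf N → Conf N) :=
    (Lp.coeFn_add _ _).trans ((Lp.coeFn_smul a p.snd).add (Lp.coeFn_smul b q.snd))
  have hac := volume_absolutelyContinuous_gibbs hV ε
  refine ⟨(hp.linear_combination hq a b).congr_ae (hac.ae_eq e1.symm) (hac.ae_eq e2.symm), ?_⟩
  filter_upwards [e1, hp', hq'] with x h1 h2 h3
  rw [h1]
  exact convex_allowedValues A D x h2 h3 ha hb hab

lemma integral_smul_eq_integral_gibbs {E : Type*} [NormedAddCommGroup E] [NormedSpace ℝ E]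
    (hV : Continuous V) (ε : ℝ) (f : Conf N → E) :
    ∫ x, f x = ∫ x, Real.exp (V x / ε) • f x ∂gibbs V ε := by
  rw [integral_gibbs hV]
  refine integral_congr_ae (Eventually.of_forall fun x => ?_)
  simp only [smul_smul, ← Real.exp_add, neg_div]
  simp

/-- Relative to the Gibbs measure, testing against φ is integration against the kernels e^{V/ε}φ and
e^{V/ε}∇φ, bounded by compact support, so the weak gradient identity survives L² limits. The
pointwise constraints pass along an a.e. convergent subsequence. -/
lemma isClosed_admissiblePairs (hV : Continuous V) [IsFiniteMeasure (gibbs V ε)] :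
    IsClosed (admissiblePairs V ε A D) := by
  refine IsSeqClosed.isClosed fun p q hp hpq => ?_
  have hfst : Tendsto (fun n => (p n).fst) atTop (𝓝 q.fst) :=
    ((WithLp.fstL 2 ℝ (Lp ℝ 2 (gibbs V ε)) (Lp (Conf N) 2 (gibbs V ε))).continuous.tendsto q).comp
      hpq
  have hsnd : Tendsto (fun n => (p n).snd) atTop (𝓝 q.snd) :=
    ((WithLp.sndL 2 ℝ (Lp ℝ 2 (gibbs V ε)) (Lp (Conf N) 2 (gibbs V ε))).continuous.tendsto q).comp
      hpq
  refine ⟨⟨locallyIntegrable_of_memLp_gibbs hV (Lp.memLp _),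
    locallyIntegrable_of_memLp_gibbs hV (Lp.memLp _), fun φ hφ hc => ?_⟩, ?_⟩
  · have hφ1 : ContDiff ℝ 1 φ := hφ.of_le (by exact_mod_cast le_top)
    have hcont1 : Continuous fun x => Real.exp (V x / ε) • gradient φ x := by
      have := continuous_gradient hφ1
      fun_prop
    have hcont2 : Continuous fun x => Real.exp (V x / ε) * φ x := by
      have := hφ.continuous
      fun_prop
    obtain ⟨C₁, hC₁⟩ := hcont1.bounded_above_of_compact_support
      ((hasCompactSupport_gradient hc).smul_left (f := fun x => Real.exp (V x / ε)))
    obtain ⟨C₂, hC₂⟩ := hcont2.bounded_above_of_compact_support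
      (hc.mul_left (f := fun x => Real.exp (V x / ε)))
    have l1 := tendsto_integral_of_tendsto_Lp hfst
      (T := fun x (t : ℝ) => t • (Real.exp (V x / ε) • gradient φ x)) (C := C₁)
      (fun x a b => by
        rw [← sub_smul, norm_smul, mul_comm]
        exact mul_le_mul_of_nonneg_right (hC₁ x) (norm_nonneg _))
      (fun x => zero_smul _ _)
      (fun w => (Lp.aestronglyMeasurable w).smul hcont1.aestronglyMeasurable)
    have l2 := tendsto_integral_of_tendsto_Lp hsnd
      (T := fun x (v : Conf N) => (Real.exp (V x / ε) * φ x) • v) (C := C₂)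
      (fun x a b => by
        rw [← smul_sub, norm_smul]
        exact mul_le_mul_of_nonneg_right (hC₂ x) (norm_nonneg _))
      (fun x => smul_zero _)
      (fun w => hcont2.aestronglyMeasurable.smul (Lp.aestronglyMeasurable w))
    have e1 : ∀ u : Conf N → ℝ, ∫ x, u x • gradient φ x
        = ∫ x, u x • (Real.exp (V x / ε) • gradient φ x) ∂gibbs V ε := fun u => by
      rw [integral_smul_eq_integral_gibbs hV ε]
      simp only [smul_comm (u _)]
    have e2 : ∀ u : Conf N → Conf N, ∫ x, φ x • u x
        = ∫ x, (Real.exp (V x / ε) * φ x) • u x ∂gibbs V ε := fun u => by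
      rw [integral_smul_eq_integral_gibbs hV ε]
      simp only [mul_smul]
    rw [e1, e2]
    refine tendsto_nhds_unique l1 (l2.neg.congr fun n => ?_)
    rw [← e1, ← e2]
    exact ((hp n).1.integral_eq φ hφ hc).symm
  · obtain ⟨ns, -, hns⟩ := (tendstoInMeasure_of_tendsto_Lp hfst).exists_seq_tendsto_ae
    filter_upwards [hns, ae_all_iff.2 fun n => (hp n).2] with x hx hpx
    exact (isClosed_allowedValues A D x).mem_of_tendsto hx
      (Eventually.of_forall fun i => hpx (ns i))

lemma IsAdmissible.mem_allowedValues {h : Conf N → ℝ} {g : Conf N → Conf N}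
    (H : IsAdmissible V ε A D h g) (x : Conf N) : h x ∈ allowedValues A D x :=
  ⟨H.mem_Icc x, H.eq_one x, H.eq_zero x⟩

lemma IsAdmissible.toLp_mem_admissiblePairs (hV : Continuous V) {h : Conf N → ℝ}
    {g : Conf N → Conf N} (H : IsAdmissible V ε A D h g) :
    WithLp.toLp 2 (H.memLp.toLp h, H.memLp_grad.toLp g) ∈ admissiblePairs V ε A D := by
  have hac := volume_absolutelyContinuous_gibbs hV ε
  refine ⟨H.hasWeakGradient.congr_ae (hac.ae_eq H.memLp.coeFn_toLp.symm)
    (hac.ae_eq H.memLp_grad.coeFn_toLp.symm), ?_⟩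
  filter_upwards [H.memLp.coeFn_toLp] with x hx
  have := H.mem_allowedValues x
  rwa [← hx] at this

/-- The gradient vanishes a.e. on A ∪ D, so integrating over the complement loses nothing. The form
becomes a convex function of the pair. -/
lemma IsAdmissible.dirichletForm_eq (hV : Continuous V) (hA : IsOpen A) (hD : IsOpen D)
    {h : Conf N → ℝ} {g : Conf N → Conf N} (H : IsAdmissible V ε A D h g) :
    dirichletForm V ε A D g = ε * ‖H.memLp_grad.toLp g‖ ^ 2 := by
  have hz : ∀ᵐ x, x ∈ A ∪ D → g x = 0 := by
    filter_upwards [H.hasWeakGradient.ae_eq_zero_of_eqOn_const hA H.eq_one,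
      H.hasWeakGradient.ae_eq_zero_of_eqOn_const hD H.eq_zero] with x h1 h2 hx
    exact hx.elim h1 h2
  rw [dirichletForm, ← real_inner_self_eq_norm_sq, L2.inner_def]
  congr 1
  have e : ∫ x, inner ℝ (H.memLp_grad.toLp g x) (H.memLp_grad.toLp g x) ∂gibbs V ε
      = ∫ x, ‖g x‖ ^ 2 ∂gibbs V ε := by
    refine integral_congr_ae ?_
    filter_upwards [H.memLp_grad.coeFn_toLp] with x hx
    rw [hx, real_inner_self_eq_norm_sq]
  rw [e, integral_gibbs hV]
  simp only [smul_eq_mul]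
  refine setIntegral_eq_integral_of_ae_compl_eq_zero ?_
  filter_upwards [hz] with x hx hx'
  rw [hx (not_notMem.1 hx')]
  simp

/-- Existence of the equilibrium potential. -/
theorem exists_isEquilibriumPotential (hV : Continuous V) (hε : 0 < ε)
    (hI : Integrable fun x : Conf N => Real.exp (-V x / ε)) (hA : IsOpen A) (hD : IsOpen D)
    (hne : ∃ h g, IsAdmissible V ε A D h g) : ∃ h, IsEquilibriumPotential V ε A D h := by
  have := isFiniteMeasure_gibbs hI
  obtain ⟨h₀, g₀, H₀⟩ := hne
  have hsub : ∀ c : ℝ, ∃ R, ∀ p ∈ admissiblePairs V ε A D, ‖p.snd‖ ≤ c → ‖p‖ ≤ R := by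
    intro c
    refine ⟨(gibbs V ε).real univ + 1 + |c|, fun p hp hpc => ?_⟩
    -- Coercivity in the function itself is free: its values lie in [0,1] and the measure is finite.
    have h1 : ‖p.fst‖ ^ 2 ≤ (gibbs V ε).real univ := by
      rw [← real_inner_self_eq_norm_sq, L2.inner_def]
      have : ∀ᵐ x ∂gibbs V ε, ‖inner ℝ (p.fst x) (p.fst x)‖ ≤ 1 := by
        filter_upwards [hp.2] with x hx
        rw [real_inner_self_eq_norm_sq, Real.norm_of_nonneg (by positivity), Real.norm_eq_abs,
          abs_of_nonneg hx.1.1]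
        exact pow_le_one₀ hx.1.1 hx.1.2
      refine (le_abs_self _).trans ((norm_integral_le_of_norm_le_const this).trans ?_)
      rw [one_mul]
    have h2 := WithLp.prod_norm_sq_eq_of_L2 p
    have h3 : ‖p.snd‖ ≤ |c| := hpc.trans (le_abs_self c)
    refine le_of_sq_le_sq ?_ (by positivity)
    have h5 : 0 ≤ (gibbs V ε).real univ := measureReal_nonneg
    have h4 := pow_le_pow_left₀ (norm_nonneg _) h3 2
    nlinarith [abs_nonneg c]
  have hcv : ConvexOn ℝ univ
      fun p : WithLp 2 (Lp ℝ 2 (gibbs V ε) × Lp (Conf N) 2 (gibbs V ε)) => ‖p.snd‖ :=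
    (convexOn_norm convex_univ).comp_linearMap (WithLp.sndₗ 2 ℝ _ _)
  have hcont : Continuous
      fun p : WithLp 2 (Lp ℝ 2 (gibbs V ε) × Lp (Conf N) 2 (gibbs V ε)) => ‖p.snd‖ :=
    (WithLp.sndL 2 ℝ (Lp ℝ 2 (gibbs V ε)) (Lp (Conf N) 2 (gibbs V ε))).continuous.norm
  obtain ⟨p, hp, hpmin⟩ := exists_forall_le_of_convexOn
    ⟨_, H₀.toLp_mem_admissiblePairs hV⟩ (isClosed_admissiblePairs (A := A) (D := D) hV)
    (convex_admissiblePairs hV) hcont hcv (fun _ => norm_nonneg _) hsub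
  classical
  -- The minimizer is only a class modulo null sets, while admissibility is pointwise; bad values
  -- are replaced by those of a given competitor.
  let h : Conf N → ℝ := fun x => if p.fst x ∈ allowedValues A D x then p.fst x else h₀ x
  have hh : (p.fst : Conf N → ℝ) =ᵐ[gibbs V ε] h := by
    filter_upwards [hp.2] with x hx
    simp only [h, if_pos hx]
  have hmem : ∀ x, h x ∈ allowedValues A D x := fun x => by
    simp only [h]
    split_ifs with hx
    · exact hx
    · exact H₀.mem_allowedValues x
  have H : IsAdmissible V ε A D h p.snd :=
    { hasWeakGradient := hp.1.congr_ae ((volume_absolutelyContinuous_gibbs hV ε).ae_eq hh)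
        (ae_eq_refl _)
      memLp := (Lp.memLp p.fst).ae_eq hh
      memLp_grad := Lp.memLp p.snd
      mem_Icc := fun x => (hmem x).1
      eq_one := fun x => (hmem x).2.1
      eq_zero := fun x => (hmem x).2.2 }
  refine ⟨h, p.snd, H, fun h' g' H' => ?_⟩
  rw [H.dirichletForm_eq hV hA hD, H'.dirichletForm_eq hV hA hD, Lp.toLp_coeFn]
  have := hpmin _ (H'.toLp_mem_admissiblePairs hV)
  gcongr
  exact this

end Existence

/-! ### Perturbation of a weighted integral -/

section Comparison

lemma abs_exp_sub_one_le_mul (x : ℝ) : |Real.exp x - 1| ≤ |x| * (1 + Real.exp x) := by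
  have h1 := Real.add_one_le_exp x
  have h2 := Real.add_one_le_exp (-x)
  have he := Real.exp_pos x
  have h3 : Real.exp x * Real.exp (-x) = 1 := by rw [← Real.exp_add]; simp
  rcases le_total 0 x with hx | hx
  · rw [abs_of_nonneg (by linarith), abs_of_nonneg hx]
    nlinarith
  · have : Real.exp x ≤ 1 := Real.exp_le_one_iff.2 hx
    rw [abs_of_nonpos (by linarith), abs_of_nonpos hx]
    nlinarith

/-- Comparison of a perturbed integral `∫ u e^X w` with `∫ w`, where `u` has values in `[0,1]` and
the perturbed weight is dominated by `w'` where `u` does not vanish. -/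
lemma abs_integral_mul_exp_mul_sub_le {α : Type*} [MeasurableSpace α] {ν : Measure α}
    {u X w w' q : α → ℝ} (hu : ∀ x, u x ∈ Icc (0 : ℝ) 1) (hw0 : ∀ x, 0 ≤ w x)
    (hw0' : ∀ x, 0 ≤ w' x)
    (hdom : ∀ x, u x ≠ 0 → Real.exp (X x) * w x ≤ w' x) (hq : ∀ x, 1 - u x ≤ q x)
    (hum : AEStronglyMeasurable u ν) (hXm : AEStronglyMeasurable X ν)
    (hw : Integrable w ν) (hw' : Integrable w' ν) (hqw : Integrable (fun x => q x * w x) ν)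
    (hXw : Integrable (fun x => |X x| * w x) ν) (hXw' : Integrable (fun x => |X x| * w' x) ν) :
    |∫ x, u x * (Real.exp (X x) * w x) ∂ν - ∫ x, w x ∂ν|
      ≤ ∫ x, q x * w x ∂ν + ∫ x, |X x| * w x ∂ν + ∫ x, |X x| * w' x ∂ν := by
  have hb : ∀ x, u x * (Real.exp (X x) * w x) ≤ u x * w' x := fun x => by
    by_cases h : u x = 0
    · simp [h]
    · exact mul_le_mul_of_nonneg_left (hdom x h) (hu x).1
  have hI : Integrable (fun x => u x * (Real.exp (X x) * w x)) ν := by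
    refine hw'.mono' (hum.mul ((Real.continuous_exp.comp_aestronglyMeasurable hXm).mul hw.1))
      (Filter.Eventually.of_forall fun x => ?_)
    have h1 := mul_nonneg (Real.exp_pos (X x)).le (hw0 x)
    rw [Real.norm_of_nonneg (mul_nonneg (hu x).1 h1)]
    exact (hb x).trans (mul_le_of_le_one_left (hw0' x) (hu x).2)
  rw [← integral_sub hI hw, ← integral_add hqw hXw, ← integral_add (hqw.fun_add hXw) hXw']
  refine (abs_integral_le_integral_abs).trans
    (integral_mono (hI.sub hw).abs ((hqw.fun_add hXw).fun_add hXw') fun x => ?_)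
  -- The error splits into the anharmonic correction where u lives and the mass missed by u.
  have h0 : u x * (Real.exp (X x) * w x) - w x
      = u x * ((Real.exp (X x) - 1) * w x) - (1 - u x) * w x := by ring
  have h1 : |u x * ((Real.exp (X x) - 1) * w x)|
      ≤ |X x| * w x + |X x| * w' x := by
    rw [abs_mul, abs_mul, abs_of_nonneg (hu x).1, abs_of_nonneg (hw0 x)]
    have h2 := mul_le_mul_of_nonneg_left (mul_le_mul_of_nonneg_right
      (abs_exp_sub_one_le_mul (X x)) (hw0 x)) (hu x).1
    have h3 := mul_le_mul_of_nonneg_left (hb x) (abs_nonneg (X x))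
    have h4 : u x * (|X x| * w x) ≤ |X x| * w x :=
      mul_le_of_le_one_left (mul_nonneg (abs_nonneg _) (hw0 x)) (hu x).2
    have h5 : u x * (|X x| * w' x) ≤ |X x| * w' x :=
      mul_le_of_le_one_left (mul_nonneg (abs_nonneg _) (hw0' x)) (hu x).2
    nlinarith
  have h2 : |(1 - u x) * w x| ≤ q x * w x := by
    rw [abs_of_nonneg (mul_nonneg (by linarith [(hu x).2]) (hw0 x))]
    exact mul_le_mul_of_nonneg_right (hq x) (hw0 x)
  simp only [h0]
  exact (abs_sub _ _).trans (by linarith)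

end Comparison

/-! ### The two quadratic forms and their coordinatewise bounds -/

section QuadraticForms

open Matrix

variable {N : ℕ}

lemma sin_pi_div_pos (hN : 2 ≤ N) : 0 < Real.sin (Real.pi / N) := by
  have hN' : (2 : ℝ) ≤ N := by exact_mod_cast hN
  refine Real.sin_pos_of_pos_of_lt_pi (by positivity) (div_lt_self Real.pi_pos (by linarith))

lemma gammaOne_pos (hN : 2 ≤ N) : 0 < gammaOne N := by
  have := sin_pi_div_pos hN
  unfold gammaOne
  positivity

/-- From sin(π/N) ≤ π/N and π² ≤ 10. This lets the coupling pay for the factor N in the Sobolev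
inequality. -/
lemma sq_le_mul_gammaOne (hN : 2 ≤ N) : (N : ℝ) ^ 2 ≤ 20 * gammaOne N := by
  have hs := sin_pi_div_pos hN
  have hN' : (2 : ℝ) ≤ N := by exact_mod_cast hN
  have h1 : Real.sin (Real.pi / N) ≤ Real.pi / N := Real.sin_le (by positivity)
  have h2 : N * Real.sin (Real.pi / N) ≤ Real.pi := by
    rwa [le_div_iff₀ (by positivity), mul_comm] at h1
  have h3 : (N * Real.sin (Real.pi / N)) ^ 2 ≤ 10 := by
    have := Real.pi_lt_d2
    have h4 : 0 ≤ N * Real.sin (Real.pi / N) := by positivity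
    nlinarith
  rw [gammaOne, mul_one_div, le_div_iff₀ (by positivity)]
  nlinarith

variable [NeZero N]

/-- The matrix of the discrete derivative `z ↦ (z i - z (i + 1))`. -/
def diffMatrix (N : ℕ) : Matrix (ZMod N) (ZMod N) ℝ :=
  Matrix.of fun k i => (if k = i then 1 else 0) - (if k + 1 = i then 1 else 0)

/-- The Hessian of the potential at its minima. -/
def hessMatrix (N : ℕ) [NeZero N] (γ : ℝ) : Matrix (ZMod N) (ZMod N) ℝ :=
  (2 : ℝ) • 1 + (γ / 2) • ((diffMatrix N)ᵀ * diffMatrix N)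

/-- A quadratic form bounding the potential from below away from `I_+`: it coincides with
`hessMatrix` up to a bounded perturbation. -/
def lowerMatrix (N : ℕ) [NeZero N] (γ β c : ℝ) : Matrix (ZMod N) (ZMod N) ℝ :=
  (γ / 2) • ((diffMatrix N)ᵀ * diffMatrix N) - β • 1
    + ((2 * c + β) / N) • vecMulVec (fun _ => 1) (fun _ => 1)

lemma diffMatrix_mulVec (z : ZMod N → ℝ) (k : ZMod N) :
    (diffMatrix N *ᵥ z) k = z k - z (k + 1) := by
  simp [diffMatrix, mulVec, dotProduct, sub_mul, Finset.sum_sub_distrib]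

lemma dotProduct_diffMatrix_mulVec (z : ZMod N → ℝ) :
    z ⬝ᵥ ((diffMatrix N)ᵀ * diffMatrix N) *ᵥ z = ∑ i, (z i - z (i + 1)) ^ 2 := by
  rw [← mulVec_mulVec, dotProduct_mulVec, vecMul_transpose, dotProduct]
  exact Finset.sum_congr rfl fun i _ => by rw [diffMatrix_mulVec]; ring

lemma dotProduct_hessMatrix_mulVec (γ : ℝ) (z : ZMod N → ℝ) :
    z ⬝ᵥ hessMatrix N γ *ᵥ z = 2 * ∑ i, z i ^ 2 + γ / 2 * ∑ i, (z i - z (i + 1)) ^ 2 := by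
  rw [hessMatrix, add_mulVec, dotProduct_add, smul_mulVec, smul_mulVec, dotProduct_smul,
    dotProduct_smul, dotProduct_diffMatrix_mulVec, one_mulVec]
  simp [dotProduct, pow_two]

lemma dotProduct_lowerMatrix_mulVec (γ β c : ℝ) (z : ZMod N → ℝ) :
    z ⬝ᵥ lowerMatrix N γ β c *ᵥ z = γ / 2 * ∑ i, (z i - z (i + 1)) ^ 2 - β * ∑ i, z i ^ 2
      + (2 * c + β) / N * (∑ i, z i) ^ 2 := by
  rw [lowerMatrix, add_mulVec, dotProduct_add, sub_mulVec, dotProduct_sub, smul_mulVec,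
    smul_mulVec, smul_mulVec, dotProduct_smul, dotProduct_smul, dotProduct_smul,
    dotProduct_diffMatrix_mulVec, one_mulVec, vecMulVec_mulVec]
  simp [dotProduct, pow_two, Finset.sum_mul]

lemma isHermitian_hessMatrix (γ : ℝ) : (hessMatrix N γ).IsHermitian := by
  rw [IsHermitian, conjTranspose_eq_transpose_of_trivial, hessMatrix]
  simp [transpose_add, transpose_smul, transpose_mul]

lemma isHermitian_lowerMatrix (γ β c : ℝ) : (lowerMatrix N γ β c).IsHermitian := by
  rw [IsHermitian, conjTranspose_eq_transpose_of_trivial, lowerMatrix]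
  simp [transpose_add, transpose_smul, transpose_mul]

/-- The variance decomposition `∑ z² = ∑ (z - m)² + N m²`. -/
lemma sum_sq_eq (z : ZMod N → ℝ) {m : ℝ} (hm : m = (∑ i, z i) / N) :
    ∑ i, z i ^ 2 = ∑ i, (z i - m) ^ 2 + N * m ^ 2 := by
  have hN : (0 : ℝ) < N := Nat.cast_pos.2 (NeZero.pos N)
  have h : ∑ i, z i = N * m := by rw [hm]; field_simp
  have e : ∀ i, (z i - m) ^ 2 = z i ^ 2 - 2 * m * z i + m ^ 2 := fun i => by ring
  simp only [e, Finset.sum_add_distrib, Finset.sum_sub_distrib, ← Finset.mul_sum, h,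
    Finset.sum_const, Finset.card_univ, ZMod.card, nsmul_eq_mul]
  ring

lemma sum_sub_mean (z : ZMod N → ℝ) {m : ℝ} (hm : m = (∑ i, z i) / N) :
    ∑ i, (z i - m) = 0 := by
  have hN : (0 : ℝ) < N := Nat.cast_pos.2 (NeZero.pos N)
  simp only [Finset.sum_sub_distrib, Finset.sum_const, Finset.card_univ, ZMod.card, nsmul_eq_mul,
    hm]
  field_simp
  ring

/-- The threshold `gammaOne` is exactly the value that normalizes the Wirtinger constant to 1 here.
-/
lemma mul_sum_sq_sub_mean_le (hN : 2 ≤ N) {μ : ℝ} (hμ : 0 < μ) (z : ZMod N → ℝ) {m : ℝ}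
    (hm : m = (∑ i, z i) / N) :
    μ * ∑ i, (z i - m) ^ 2 ≤ μ * gammaOne N / 2 * ∑ i, (z i - z (i + 1)) ^ 2 := by
  have hs := sin_pi_div_pos hN
  have h := wirtinger (fun i => z i - m) (sum_sub_mean z hm)
  simp only [sub_sub_sub_cancel_right] at h
  rw [gammaOne]
  calc μ * ∑ i, (z i - m) ^ 2
      = μ * (1 / (2 * Real.sin (Real.pi / N) ^ 2)) / 2
          * (4 * Real.sin (Real.pi / N) ^ 2 * ∑ i, (z i - m) ^ 2) := by field_simp; ring
    _ ≤ _ := by gcongr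

lemma sq_le_sum_sq_add_gammaOne (hN : 2 ≤ N) {μ : ℝ} (hμ : 1 < μ) (z : ZMod N → ℝ) (i : ZMod N) :
    z i ^ 2 ≤ (2 * ∑ j, z j ^ 2 + 80 * (μ * gammaOne N / 2 * ∑ j, (z j - z (j + 1)) ^ 2)) / N := by
  have hN' : (0 : ℝ) < N := Nat.cast_pos.2 (NeZero.pos N)
  have h := sq_le_sum_sq_add z i
  have hg := sq_le_mul_gammaOne hN
  have hg0 := gammaOne_pos hN
  have hS : 0 ≤ ∑ j, (z j - z (j + 1)) ^ 2 := Finset.sum_nonneg fun _ _ => sq_nonneg _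
  set S := ∑ j, (z j - z (j + 1)) ^ 2
  have h2 : (N : ℝ) ^ 2 * S ≤ 20 * (μ * gammaOne N) * S := by
    refine mul_le_mul_of_nonneg_right (hg.trans ?_) hS
    nlinarith
  rw [le_div_iff₀ hN']
  calc z i ^ 2 * N ≤ (2 / N * ∑ j, z j ^ 2 + 2 * N * S) * N := by gcongr
    _ = 2 * ∑ j, z j ^ 2 + 2 * (N ^ 2 * S) := by field_simp
    _ ≤ _ := by linarith

/-- The constant in the Sobolev bound for the two quadratic forms. -/
def sobolevConst (μ c : ℝ) : ℝ := 164 * μ / (μ - 1) + 1 / c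

lemma sobolevConst_pos {μ c : ℝ} (hμ : 1 < μ) (hc : 0 < c) : 0 < sobolevConst μ c := by
  have : 0 < μ - 1 := by linarith
  unfold sobolevConst
  positivity

/-- The parameter c is foreign to this form; it is carried so that both forms share one constant. -/
lemma sq_le_hessMatrix (hN : 2 ≤ N) {μ c : ℝ} (hμ : 1 < μ) (hc : 0 < c) (i : ZMod N)
    (z : ZMod N → ℝ) :
    z i ^ 2 ≤ sobolevConst μ c / N * (z ⬝ᵥ hessMatrix N (μ * gammaOne N) *ᵥ z) := by
  have hN' : (0 : ℝ) < N := Nat.cast_pos.2 (NeZero.pos N)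
  have h := sq_le_sum_sq_add_gammaOne hN hμ z i
  rw [dotProduct_hessMatrix_mulVec, div_mul_eq_mul_div]
  refine h.trans (div_le_div_of_nonneg_right ?_ hN'.le)
  have hg0 := gammaOne_pos hN
  have hS : 0 ≤ μ * gammaOne N / 2 * ∑ j, (z j - z (j + 1)) ^ 2 :=
    mul_nonneg (by positivity) (Finset.sum_nonneg fun _ _ => sq_nonneg _)
  have hT : 0 ≤ ∑ j, z j ^ 2 := Finset.sum_nonneg fun _ _ => sq_nonneg _
  have hC : 80 ≤ sobolevConst μ c := by
    have h1 : 164 ≤ 164 * μ / (μ - 1) := by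
      rw [le_div_iff₀ (by linarith)]
      linarith
    have h2 : 0 < 1 / c := by positivity
    unfold sobolevConst
    linarith
  have h3 := mul_le_mul_of_nonneg_right hC hS
  have h4 := mul_le_mul_of_nonneg_right hC hT
  linarith

/-- The choice β = (1 + μ)/2 < μ leaves a fixed fraction of the coupling energy to control
fluctuations about the mean, and the rank-one term controls the mean. -/
lemma sq_le_lowerMatrix (hN : 2 ≤ N) {μ c : ℝ} (hμ : 1 < μ) (hc : 0 < c) (i : ZMod N)
    (z : ZMod N → ℝ) :
    z i ^ 2 ≤ sobolevConst μ c / N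
      * (z ⬝ᵥ lowerMatrix N (μ * gammaOne N) ((1 + μ) / 2) c *ᵥ z) := by
  have hN' : (0 : ℝ) < N := Nat.cast_pos.2 (NeZero.pos N)
  have h := sq_le_sum_sq_add_gammaOne hN hμ z i
  rw [dotProduct_lowerMatrix_mulVec, div_mul_eq_mul_div]
  refine h.trans (div_le_div_of_nonneg_right ?_ hN'.le)
  have hg0 := gammaOne_pos hN
  set m := (∑ i, z i) / N with hm
  have hW := mul_sum_sq_sub_mean_le hN (by linarith : 0 < μ) z hm
  have hsum : ∑ i, z i = N * m := by rw [hm]; field_simp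
  rw [sum_sq_eq z hm, hsum]
  have hW0 : 0 ≤ ∑ j, (z j - m) ^ 2 := Finset.sum_nonneg fun _ _ => sq_nonneg _
  set W := ∑ j, (z j - m) ^ 2
  set P := μ * gammaOne N / 2 * ∑ j, (z j - z (j + 1)) ^ 2
  have e : P - (1 + μ) / 2 * (W + N * m ^ 2) + (2 * c + (1 + μ) / 2) / N * (N * m) ^ 2
      = (P - (1 + μ) / 2 * W) + 2 * c * (N * m ^ 2) := by field_simp; ring
  rw [e]
  have hμ1 : 0 < μ - 1 := by linarith
  have hP : (μ - 1) / (2 * μ) * P ≤ P - (1 + μ) / 2 * W := by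
    have : P - (1 + μ) / 2 * W - (μ - 1) / (2 * μ) * P = (1 + μ) / (2 * μ) * (P - μ * W) := by
      field_simp; ring
    have h2 : 0 ≤ (1 + μ) / (2 * μ) * (P - μ * W) := mul_nonneg (by positivity) (by linarith)
    linarith
  have hP0 : 0 ≤ P := le_trans (by positivity) hW
  have hWP : W ≤ P := by nlinarith
  have hM : 0 ≤ N * m ^ 2 := by positivity
  -- 82 = 80 + 2: the fluctuation part of 2∑ z_j² is bounded by 2P through W ≤ P.
  have h1 : 82 * P ≤ 164 * μ / (μ - 1) * (P - (1 + μ) / 2 * W) := by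
    calc 82 * P = 164 * μ / (μ - 1) * ((μ - 1) / (2 * μ) * P) := by field_simp; ring
      _ ≤ _ := by gcongr
  have h2 : 2 * (N * m ^ 2) = 1 / c * (2 * c * (N * m ^ 2)) := by field_simp
  have h3 : 0 ≤ 1 / c * (P - (1 + μ) / 2 * W) :=
    mul_nonneg (by positivity) (le_trans (by positivity) hP)
  have h4 : 0 ≤ 164 * μ / (μ - 1) * (2 * c * (N * m ^ 2)) := by positivity
  unfold sobolevConst
  nlinarith

lemma posDef_of_sq_le {A : Matrix (ZMod N) (ZMod N) ℝ} (hA : A.IsHermitian) {K : ℝ} (hK : 0 < K)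
    (h : ∀ i, ∀ z : ZMod N → ℝ, z i ^ 2 ≤ K * (z ⬝ᵥ A *ᵥ z)) : A.PosDef := by
  refine PosDef.of_dotProduct_mulVec_pos hA fun z hz => ?_
  obtain ⟨i, hi⟩ := Function.ne_iff.1 hz
  have hi' : z i ≠ 0 := hi
  have h1 : 0 < z i ^ 2 := by positivity
  exact pos_of_mul_pos_right (h1.trans_le (h i z)) hK.le

lemma hessMatrix_le_lowerMatrix_add {γ β c : ℝ} (hβ : 0 ≤ β) (hc : 0 ≤ c) (z : ZMod N → ℝ) :
    z ⬝ᵥ hessMatrix N γ *ᵥ z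
      ≤ z ⬝ᵥ lowerMatrix N γ β c *ᵥ z + (2 + β) * ∑ i, z i ^ 2 := by
  rw [dotProduct_hessMatrix_mulVec, dotProduct_lowerMatrix_mulVec]
  have : 0 ≤ (2 * c + β) / N * (∑ i, z i) ^ 2 := by positivity
  linarith

end QuadraticForms

/-! ### The Hessian at the minimum -/

section Hessian

variable {N : ℕ} [NeZero N]

lemma contDiff_potentialF (γ : ℝ) : ContDiff ℝ ∞ (potentialF γ : Conf N → ℝ) := by
  unfold potentialF
  fun_prop

lemma fderiv_apply_of_hasDerivAt {f : Conf N → ℝ} {x v : Conf N} {f' : ℝ}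
    (hf : DifferentiableAt ℝ f x) (h : HasDerivAt (fun t : ℝ => f (x + t • v)) f' 0) :
    fderiv ℝ f x v = f' :=
  HasDerivAt.unique (hf.hasFDerivAt.hasLineDerivAt v) h

lemma fderiv_potentialF (γ : ℝ) (x v : Conf N) :
    fderiv ℝ (potentialF γ) x v = ∑ k, (x k ^ 3 - x k) * v k
      + γ / 2 * ∑ k, (x k - x (k + 1)) * (v k - v (k + 1)) := by
  refine fderiv_apply_of_hasDerivAt
    ((contDiff_potentialF γ).differentiable (by simp)).differentiableAt ?_
  have hk : ∀ k, HasDerivAt (fun t : ℝ => (x + t • v) k) (v k) 0 := fun k => by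
    simpa using ((hasDerivAt_id (0 : ℝ)).mul_const (v k)).const_add (x k)
  have h1 : HasDerivAt (fun t : ℝ => ∑ k, ((1 / 4 : ℝ) * (x + t • v) k ^ 4
      - (1 / 2 : ℝ) * (x + t • v) k ^ 2)) (∑ k, (x k ^ 3 - x k) * v k) 0 := by
    refine HasDerivAt.fun_sum fun k _ => ?_
    refine ((((hk k).fun_pow 4).const_mul (1 / 4 : ℝ)).fun_sub
      (((hk k).fun_pow 2).const_mul (1 / 2 : ℝ))).congr_deriv ?_
    simp
    ring
  have h2 : HasDerivAt (fun t : ℝ => ∑ k, ((x + t • v) k - (x + t • v) (k + 1)) ^ 2)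
      (∑ k, 2 * ((x k - x (k + 1)) * (v k - v (k + 1)))) 0 := by
    refine HasDerivAt.fun_sum fun k _ => ?_
    refine (((hk k).fun_sub (hk (k + 1))).fun_pow 2).congr_deriv ?_
    simp
    ring
  refine (h1.fun_add (h2.const_mul (γ / 4))).congr_deriv ?_
  rw [← Finset.mul_sum]
  ring

lemma fderiv_fderiv_potentialF (γ : ℝ) (x u v : Conf N) :
    fderiv ℝ (fun y => fderiv ℝ (potentialF γ) y v) x u = ∑ k, (3 * x k ^ 2 - 1) * u k * v k
      + γ / 2 * ∑ k, (u k - u (k + 1)) * (v k - v (k + 1)) := by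
  simp only [fderiv_potentialF]
  refine fderiv_apply_of_hasDerivAt (by fun_prop) ?_
  have hk : ∀ k, HasDerivAt (fun t : ℝ => (x + t • u) k) (u k) 0 := fun k => by
    simpa using ((hasDerivAt_id (0 : ℝ)).mul_const (u k)).const_add (x k)
  have h1 : HasDerivAt (fun t : ℝ => ∑ k, ((x + t • u) k ^ 3 - (x + t • u) k) * v k)
      (∑ k, (3 * x k ^ 2 - 1) * u k * v k) 0 := by
    refine HasDerivAt.fun_sum fun k _ => ?_
    refine ((((hk k).fun_pow 3).fun_sub (hk k)).mul_const (v k)).congr_deriv ?_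
    simp only [zero_smul, add_zero, Nat.cast_ofNat]
    ring
  have h2 : HasDerivAt (fun t : ℝ => ∑ k, ((x + t • u) k - (x + t • u) (k + 1))
      * (v k - v (k + 1))) (∑ k, (u k - u (k + 1)) * (v k - v (k + 1))) 0 :=
    HasDerivAt.fun_sum fun k _ => ((hk k).fun_sub (hk (k + 1))).mul_const _
  exact h1.fun_add (h2.const_mul (γ / 2))

lemma hessian_potentialF_Iminus (γ : ℝ) :
    hessian (potentialF γ) (Iminus N) = hessMatrix N γ := by
  ext i j
  rw [hessian, Matrix.of_apply, fderiv_fderiv_potentialF]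
  simp only [hessMatrix, Matrix.add_apply, Matrix.smul_apply, Matrix.mul_apply, smul_eq_mul,
    Matrix.transpose_apply, diffMatrix, Matrix.of_apply, Iminus, PiLp.single_apply, Matrix.one_apply]
  congr 1
  rcases eq_or_ne i j with rfl | hij
  · simp
    norm_num
  · simp [hij, hij.symm]

end Hessian

/-! ### Expansion at `I_-` and the global lower bound outside the ball around `I_+` -/

section Potential

open Matrix

variable {N : ℕ}

lemma Iminus_add_apply (z : Conf N) (i : ZMod N) : (Iminus N + z) i = z i - 1 := by
  simp [Iminus]
  ring

variable [NeZero N]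

lemma continuous_potentialG (γ : ℝ) : Continuous (potentialG γ : Conf N → ℝ) :=
  continuous_const.mul (contDiff_potentialF γ).continuous

/-- The anharmonic part of the potential at `I_-`, in units of `N ε`. -/
def anharmonic (N : ℕ) [NeZero N] (ε : ℝ) (z : Conf N) : ℝ :=
  (N * ε)⁻¹ * ∑ i, (z i ^ 3 - z i ^ 4 / 4)

lemma continuous_anharmonic (ε : ℝ) : Continuous (anharmonic N ε) := by
  unfold anharmonic
  fun_prop

lemma potentialG_Iminus_add (γ : ℝ) (z : Conf N) :
    potentialG γ (Iminus N + z) = -(1 / 4) + (N : ℝ)⁻¹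
      * ((z.ofLp ⬝ᵥ hessMatrix N γ *ᵥ z.ofLp) / 2 - ∑ i, (z i ^ 3 - z i ^ 4 / 4)) := by
  have hN : (0 : ℝ) < N := Nat.cast_pos.2 (NeZero.pos N)
  rw [dotProduct_hessMatrix_mulVec, potentialG, potentialF]
  simp only [Iminus_add_apply, sub_sub_sub_cancel_right]
  have e : ∀ i, (1 / 4 : ℝ) * (z i - 1) ^ 4 - 1 / 2 * (z i - 1) ^ 2
      = -(1 / 4) + z i ^ 2 - (z i ^ 3 - z i ^ 4 / 4) := fun i => by ring
  simp only [e, Finset.sum_sub_distrib, Finset.sum_add_distrib, Finset.sum_const,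
    Finset.card_univ, ZMod.card, nsmul_eq_mul]
  field_simp
  ring

lemma exp_neg_potentialG_Iminus_add (γ : ℝ) {ε : ℝ} (hε : 0 < ε) (z : Conf N) :
    Real.exp (-potentialG γ (Iminus N + z) / ε) = Real.exp (1 / (4 * ε))
      * (Real.exp (anharmonic N ε z) * gaussDensity ((N * ε : ℝ)⁻¹ • hessMatrix N γ) z) := by
  have hN : (0 : ℝ) < N := Nat.cast_pos.2 (NeZero.pos N)
  rw [gaussDensity, ← Real.exp_add, ← Real.exp_add, potentialG_Iminus_add, anharmonic,
    smul_mulVec, dotProduct_smul, smul_eq_mul]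
  congr 1
  field_simp
  ring

/-- The difference of the two sides is v² times a sum of squares. With m the mean and v the
fluctuation, the linear term sums to zero and only v²/2 is lost. -/
lemma quartic_ge (m v : ℝ) :
    m ^ 2 * (m - 2) ^ 2 / 4 + m * (m - 1) * (m - 2) * v - v ^ 2 / 2
      ≤ (m + v) ^ 2 - ((m + v) ^ 3 - (m + v) ^ 4 / 4) := by
  have : (m + v) ^ 2 - ((m + v) ^ 3 - (m + v) ^ 4 / 4) - (m ^ 2 * (m - 2) ^ 2 / 4
      + m * (m - 1) * (m - 2) * v - v ^ 2 / 2)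
      = v ^ 2 * ((m - 1 + v / 2) ^ 2 + (m - 1) ^ 2 / 2) := by ring
  nlinarith [show 0 ≤ v ^ 2 * ((m - 1 + v / 2) ^ 2 + (m - 1) ^ 2 / 2) by positivity]

/-- The coefficient of the lower bounding quadratic form along the diagonal. -/
def diagonalConst (μ ρ : ℝ) : ℝ := min (ρ ^ 2 / 16) ((μ - 1) * ρ ^ 2 / 48)

lemma diagonalConst_pos {μ ρ : ℝ} (hμ : 1 < μ) (hρ : 0 < ρ) : 0 < diagonalConst μ ρ := by
  have : 0 < μ - 1 := by linarith
  exact lt_min (by positivity) (by positivity)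

/-- Either the mean m is away from the well at 2 and the quartic is coercive in m, or m is bounded
and the fluctuation q is at least 3ρ²/4. -/
lemma diagonalConst_mul_sq_le {μ ρ m q : ℝ} (hμ : 1 < μ) (hρ : 0 < ρ) (hρ' : ρ < 1) (hq0 : 0 ≤ q)
    (hq : ρ ^ 2 ≤ (m - 2) ^ 2 + q) :
    diagonalConst μ ρ * m ^ 2 ≤ m ^ 2 * (m - 2) ^ 2 / 4 + (μ - 1) / 4 * q := by
  have hμ1 : 0 < μ - 1 := by linarith
  rcases le_total (ρ ^ 2 / 4) ((m - 2) ^ 2) with h | h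
  · have h1 : diagonalConst μ ρ * m ^ 2 ≤ ρ ^ 2 / 16 * m ^ 2 :=
      mul_le_mul_of_nonneg_right (min_le_left _ _) (sq_nonneg m)
    have h2 := mul_le_mul_of_nonneg_left h (sq_nonneg m)
    have h3 : 0 ≤ (μ - 1) / 4 * q := by positivity
    linarith
  · have h1 : diagonalConst μ ρ * m ^ 2 ≤ (μ - 1) * ρ ^ 2 / 48 * m ^ 2 :=
      mul_le_mul_of_nonneg_right (min_le_right _ _) (sq_nonneg m)
    have h2 : m ^ 2 ≤ 9 := by
      have h4 : (m - 2) ^ 2 ≤ 1 ^ 2 := by nlinarith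
      have h5 := abs_le_of_sq_le_sq' h4 (by norm_num)
      nlinarith [h5.1, h5.2]
    have h3 : (μ - 1) * ρ ^ 2 / 48 * m ^ 2 ≤ (μ - 1) * ρ ^ 2 / 48 * 9 :=
      mul_le_mul_of_nonneg_left h2 (by positivity)
    have h4 : (μ - 1) / 4 * (3 / 4 * ρ ^ 2) ≤ (μ - 1) / 4 * q :=
      mul_le_mul_of_nonneg_left (by linarith) (by positivity)
    have h5 : 0 ≤ m ^ 2 * (m - 2) ^ 2 / 4 := by positivity
    nlinarith [mul_pos hμ1 (pow_pos hρ 2)]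

lemma sum_sq_ge_of_notMem_Bplus {ρ : ℝ} (hρ : 0 < ρ) {z : Conf N}
    (hz : Iminus N + z ∉ Bplus N ρ) : ρ ^ 2 * N ≤ ∑ i, (z i - 2) ^ 2 := by
  have hN : (0 : ℝ) < N := Nat.cast_pos.2 (NeZero.pos N)
  rw [Bplus, Metric.mem_ball, not_lt, dist_eq_norm] at hz
  have h := pow_le_pow_left₀ (by positivity) hz 2
  rw [mul_pow, Real.sq_sqrt hN.le, EuclideanSpace.real_norm_sq_eq] at h
  refine h.trans (le_of_eq (Finset.sum_congr rfl fun i _ => ?_))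
  rw [PiLp.sub_apply, Iminus_add_apply]
  simp only [Iplus]
  ring

lemma sum_sq_ge_of_notMem_Bminus {ρ : ℝ} (hρ : 0 < ρ) {z : Conf N}
    (hz : Iminus N + z ∉ Bminus N ρ) : ρ ^ 2 * N ≤ ∑ i, z i ^ 2 := by
  have hN : (0 : ℝ) < N := Nat.cast_pos.2 (NeZero.pos N)
  rw [Bminus, Metric.mem_ball, not_lt, dist_eq_norm] at hz
  have h := pow_le_pow_left₀ (by positivity) hz 2
  rwa [mul_pow, Real.sq_sqrt hN.le, add_sub_cancel_left, EuclideanSpace.real_norm_sq_eq] at h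

/-- Outside of the ball around `I_+` the potential dominates the form `lowerMatrix`. -/
lemma lowerMatrix_le {μ ρ γ : ℝ} (hμ : 1 < μ) (hρ : 0 < ρ) (hρ' : ρ < 1) {z : Conf N}
    (hz : Iminus N + z ∉ Bplus N ρ) :
    (z.ofLp ⬝ᵥ lowerMatrix N γ ((1 + μ) / 2) (diagonalConst μ ρ) *ᵥ z.ofLp) / 2
      ≤ (z.ofLp ⬝ᵥ hessMatrix N γ *ᵥ z.ofLp) / 2 - ∑ i, (z i ^ 3 - z i ^ 4 / 4) := by
  have hN : (0 : ℝ) < N := Nat.cast_pos.2 (NeZero.pos N)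
  rw [dotProduct_lowerMatrix_mulVec, dotProduct_hessMatrix_mulVec]
  set m := (∑ i, z i) / N with hm
  have hsum : ∑ i, z i = N * m := by rw [hm]; field_simp
  set W := ∑ i, (z i - m) ^ 2 with hW
  have hW0 : 0 ≤ W := Finset.sum_nonneg fun _ _ => sq_nonneg _
  have hsq := sum_sq_eq z.ofLp hm
  have h1 : N * (m ^ 2 * (m - 2) ^ 2 / 4) - W / 2
      ≤ ∑ i, z i ^ 2 - ∑ i, (z i ^ 3 - z i ^ 4 / 4) := by
    rw [← Finset.sum_sub_distrib]
    have h2 : ∀ i ∈ (Finset.univ : Finset (ZMod N)), m ^ 2 * (m - 2) ^ 2 / 4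
        + m * (m - 1) * (m - 2) * (z i - m) - (z i - m) ^ 2 / 2
        ≤ z i ^ 2 - (z i ^ 3 - z i ^ 4 / 4) := fun i _ => by
      have := quartic_ge m (z i - m)
      rwa [add_sub_cancel] at this
    refine le_trans (le_of_eq ?_) (Finset.sum_le_sum h2)
    rw [Finset.sum_sub_distrib, Finset.sum_add_distrib, ← Finset.mul_sum,
      sum_sub_mean z.ofLp hm, hW, Finset.sum_div]
    simp only [Finset.sum_const, Finset.card_univ, ZMod.card, nsmul_eq_mul, mul_zero, add_zero]
  -- The squared distance to `I_+` decomposes into N(m - 2)² + W.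
  have h3 : ρ ^ 2 ≤ (m - 2) ^ 2 + W / N := by
    have h4 := sum_sq_ge_of_notMem_Bplus hρ hz
    have e : ∀ i, (z i - 2) ^ 2 = z i ^ 2 - 4 * z i + 4 := fun i => by ring
    simp only [e, Finset.sum_add_distrib, Finset.sum_sub_distrib, ← Finset.mul_sum, hsum, hsq,
      Finset.sum_const, Finset.card_univ, ZMod.card, nsmul_eq_mul] at h4
    rw [← mul_le_mul_iff_left₀ hN]
    refine h4.trans (le_of_eq ?_)
    field_simp
    ring
  -- The weight (μ - 1)/4 is the slack between β/2 = (1 + μ)/4 and the loss 1/2 of the quartic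
  -- bound.
  have h5 := diagonalConst_mul_sq_le hμ hρ hρ' (by positivity : 0 ≤ W / N) h3
  have h6 := mul_le_mul_of_nonneg_left h5 hN.le
  have h7 : (N : ℝ) * ((μ - 1) / 4 * (W / N)) = (μ - 1) / 4 * W := by field_simp
  rw [mul_add, h7] at h6
  have h8 : (2 * diagonalConst μ ρ + (1 + μ) / 2) / N * (N * m) ^ 2
      = (2 * diagonalConst μ ρ + (1 + μ) / 2) * (N * m ^ 2) := by field_simp
  have hsq' : ∑ i, z i ^ 2 = W + N * m ^ 2 := hsq
  rw [hsum, h8, hsq']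
  rw [hsq'] at h1
  linarith

end Potential

/-! ### Dimension-free moments of the anharmonic part -/

section Moments

open Matrix

variable {N : ℕ} [NeZero N]

/-- The cubic term is split with weight √ε: for second and fourth moments of order ε and ε², both
pieces are then of order ε^{3/2}. -/
lemma abs_anharmonic_le {ε : ℝ} (hε : 0 < ε) (z : Conf N) :
    |anharmonic N ε z| ≤ (N * ε)⁻¹ * ∑ i, (√ε * z i ^ 2 + (1 / √ε + 1 / 4) * z i ^ 4) := by
  have hN : (0 : ℝ) < N := Nat.cast_pos.2 (NeZero.pos N)
  rw [anharmonic, abs_mul, abs_of_pos (by positivity : (0 : ℝ) < (N * ε)⁻¹)]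
  refine mul_le_mul_of_nonneg_left ?_ (by positivity)
  refine (Finset.abs_sum_le_sum_abs _ _).trans (Finset.sum_le_sum fun i _ => ?_)
  have h1 := abs_pow_three_le (Real.sqrt_pos.2 hε) (z i)
  have h2 : |z i ^ 4 / 4| = z i ^ 4 / 4 := abs_of_nonneg (by positivity)
  have h3 := abs_sub (z i ^ 3) (z i ^ 4 / 4)
  rw [h2, abs_pow] at h3
  have h4 : (1 / √ε + 1 / 4) * z i ^ 4 = z i ^ 4 / √ε + z i ^ 4 / 4 := by ring
  linarith

variable {A : Matrix (ZMod N) (ZMod N) ℝ} {C ε : ℝ}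

lemma integral_abs_anharmonic_mul_gaussDensity_le (hA : A.PosDef) (hC : 0 < C) (hε : 0 < ε)
    (hε1 : ε ≤ 1) (hb : ∀ i, ∀ w : ZMod N → ℝ, w i ^ 2 ≤ C * ε * (w ⬝ᵥ A *ᵥ w)) :
    Integrable (fun z : Conf N => |anharmonic N ε z| * gaussDensity A z) ∧
    ∫ z : Conf N, |anharmonic N ε z| * gaussDensity A z
      ≤ (8 * C + 80 * C ^ 2) * √ε * ∫ z, gaussDensity A z := by
  have hN : (0 : ℝ) < N := Nat.cast_pos.2 (NeZero.pos N)
  have h2 := fun i => integral_sq_mul_gaussDensity_le hA (by positivity : 0 < C * ε) (hb i)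
  have h4 := fun i => integral_pow_four_mul_gaussDensity_le hA (by positivity : 0 < C * ε) (hb i)
  have hi : ∀ i, Integrable fun z : Conf N =>
      √ε * (z i ^ 2 * gaussDensity A z) + (1 / √ε + 1 / 4) * (z i ^ 4 * gaussDensity A z) :=
    fun i => ((h2 i).1.const_mul _).add ((h4 i).1.const_mul _)
  have hI : Integrable fun z : Conf N => (N * ε)⁻¹ * ∑ i,
      (√ε * (z i ^ 2 * gaussDensity A z) + (1 / √ε + 1 / 4) * (z i ^ 4 * gaussDensity A z)) :=
    (integrable_finsetSum _ fun i _ => hi i).const_mul _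
  have hpt : ∀ z : Conf N, |anharmonic N ε z| * gaussDensity A z ≤ (N * ε)⁻¹ * ∑ i,
      (√ε * (z i ^ 2 * gaussDensity A z) + (1 / √ε + 1 / 4) * (z i ^ 4 * gaussDensity A z)) := by
    intro z
    refine (mul_le_mul_of_nonneg_right (abs_anharmonic_le hε z) (gaussDensity_pos A z).le).trans
      (le_of_eq ?_)
    rw [mul_assoc, Finset.sum_mul]
    congr 1
    exact Finset.sum_congr rfl fun i _ => by ring
  have hint : Integrable (fun z : Conf N => |anharmonic N ε z| * gaussDensity A z) := by
    refine hI.mono' (((continuous_anharmonic ε).abs.mul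
      (continuous_gaussDensity A)).aestronglyMeasurable) (Filter.Eventually.of_forall fun z => ?_)
    rw [Real.norm_of_nonneg (mul_nonneg (abs_nonneg _) (gaussDensity_pos A z).le)]
    exact hpt z
  refine ⟨hint, (integral_mono hint hI hpt).trans ?_⟩
  have hZ : 0 ≤ ∫ z, gaussDensity A z := integral_nonneg fun z => (gaussDensity_pos A z).le
  rw [integral_const_mul, integral_finsetSum _ fun i _ => hi i]
  set Z := ∫ z, gaussDensity A z
  have hs : 0 < √ε := Real.sqrt_pos.2 hε
  have hs1 : √ε ≤ 1 := Real.sqrt_le_one.2 hε1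
  have hsε : √ε ^ 2 = ε := Real.sq_sqrt hε.le
  have hterm : ∀ i ∈ (Finset.univ : Finset (ZMod N)), ∫ z : Conf N,
      √ε * (z i ^ 2 * gaussDensity A z) + (1 / √ε + 1 / 4) * (z i ^ 4 * gaussDensity A z)
      ≤ √ε * (8 * (C * ε) * Z) + (1 / √ε + 1 / 4) * (64 * (C * ε) ^ 2 * Z) := fun i _ => by
    rw [integral_add ((h2 i).1.const_mul _) ((h4 i).1.const_mul _), integral_const_mul,
      integral_const_mul]
    gcongr
    · exact (h2 i).2
    · exact (h4 i).2
  refine (mul_le_mul_of_nonneg_left (Finset.sum_le_card_nsmul _ _ _ hterm)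
    (by positivity)).trans ?_
  rw [Finset.card_univ, ZMod.card, nsmul_eq_mul]
  have e : (N * ε)⁻¹ * (N * (√ε * (8 * (C * ε) * Z) + (1 / √ε + 1 / 4) * (64 * (C * ε) ^ 2 * Z)))
      = (8 * C * √ε + (√ε ^ 2 / √ε) * 64 * C ^ 2 + 16 * C ^ 2 * √ε ^ 2) * Z := by
    rw [hsε]
    field_simp
    ring
  rw [e]
  refine mul_le_mul_of_nonneg_right ?_ hZ
  have h5 : √ε ^ 2 / √ε = √ε := by field_simp
  rw [h5]
  have h6 : C ^ 2 * √ε ^ 2 ≤ C ^ 2 * √ε := by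
    refine mul_le_mul_of_nonneg_left ?_ (sq_nonneg C)
    nlinarith
  linarith

/-- With r = ρ² this is the Markov bound for the mass outside the ball around `I_-`. -/
lemma integral_sum_sq_mul_gaussDensity_le (hA : A.PosDef) (hC : 0 < C) (hε : 0 < ε)
    (hb : ∀ i, ∀ w : ZMod N → ℝ, w i ^ 2 ≤ C * ε * (w ⬝ᵥ A *ᵥ w)) {r : ℝ} (hr : 0 < r) :
    Integrable (fun z : Conf N => ((r * N)⁻¹ * ∑ i, z i ^ 2) * gaussDensity A z) ∧
    ∫ z : Conf N, ((r * N)⁻¹ * ∑ i, z i ^ 2) * gaussDensity A z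
      ≤ 8 * C / r * ε * ∫ z, gaussDensity A z := by
  have hN : (0 : ℝ) < N := Nat.cast_pos.2 (NeZero.pos N)
  have h2 := fun i => integral_sq_mul_gaussDensity_le hA (by positivity : 0 < C * ε) (hb i)
  simp only [mul_assoc, Finset.sum_mul]
  refine ⟨(integrable_finsetSum _ fun i _ => (h2 i).1).const_mul _, ?_⟩
  rw [integral_const_mul, integral_finsetSum _ fun i _ => (h2 i).1]
  refine (mul_le_mul_of_nonneg_left (Finset.sum_le_card_nsmul _ _ _ fun i _ => (h2 i).2)
    (by positivity)).trans (le_of_eq ?_)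
  rw [Finset.card_univ, ZMod.card, nsmul_eq_mul]
  field_simp

end Moments

/-! ### The mass estimate, integrability and an admissible function -/

section Mass

open Matrix

variable {N : ℕ} [NeZero N]

/-- The constant in the error term of the mass estimate. -/
def massConst (μ ρ : ℝ) : ℝ :=
  let C := sobolevConst μ (diagonalConst μ ρ)
  8 * C / ρ ^ 2 + (8 * C + 80 * C ^ 2) * (1 + Real.exp (4 * (2 + (1 + μ) / 2) * C))

lemma massConst_pos {μ ρ : ℝ} (hμ : 1 < μ) (hρ : 0 < ρ) : 0 < massConst μ ρ := by
  have := sobolevConst_pos hμ (diagonalConst_pos hμ hρ)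
  unfold massConst
  positivity

lemma sq_le_smul_of_sq_le {A : Matrix (ZMod N) (ZMod N) ℝ} {C ε : ℝ} (hε : 0 < ε)
    (h : ∀ i, ∀ z : ZMod N → ℝ, z i ^ 2 ≤ C / N * (z ⬝ᵥ A *ᵥ z)) (i : ZMod N) (z : ZMod N → ℝ) :
    z i ^ 2 ≤ C * ε * (z ⬝ᵥ ((N * ε : ℝ)⁻¹ • A) *ᵥ z) := by
  have hN : (0 : ℝ) < N := Nat.cast_pos.2 (NeZero.pos N)
  rw [smul_mulVec, dotProduct_smul, smul_eq_mul]
  refine (h i z).trans (le_of_eq ?_)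
  field_simp

lemma posDef_smul_hessMatrix (hN : 2 ≤ N) {μ ε : ℝ} (hμ : 1 < μ) (hε : 0 < ε) :
    ((N * ε : ℝ)⁻¹ • hessMatrix N (μ * gammaOne N)).PosDef :=
  posDef_of_sq_le ((isHermitian_hessMatrix _).smul (.all _))
    (mul_pos (sobolevConst_pos hμ one_pos) hε)
    (sq_le_smul_of_sq_le hε (sq_le_hessMatrix hN hμ one_pos))

/-- Laplace asymptotics, uniform in the dimension, for the mass of a function with values in
`[0,1]` equal to `1` on the ball around `I_-` and to `0` on the ball around `I_+`. -/
lemma abs_integral_mass_sub_le (hN : 2 ≤ N) {μ ρ ε : ℝ} (hμ : 1 < μ) (hρ : 0 < ρ) (hρ' : ρ < 1)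
    (hε : 0 < ε) (hε1 : ε ≤ 1) {u : Conf N → ℝ} (hu : ∀ z, u z ∈ Icc (0 : ℝ) 1)
    (hum : AEStronglyMeasurable u) (hu1 : ∀ z, Iminus N + z ∈ Bminus N ρ → u z = 1)
    (hu0 : ∀ z, Iminus N + z ∈ Bplus N ρ → u z = 0) :
    |(∫ z, u z * (Real.exp (anharmonic N ε z)
        * gaussDensity ((N * ε : ℝ)⁻¹ • hessMatrix N (μ * gammaOne N)) z))
      - ∫ z, gaussDensity ((N * ε : ℝ)⁻¹ • hessMatrix N (μ * gammaOne N)) z|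
      ≤ massConst μ ρ * √ε
        * ∫ z, gaussDensity ((N * ε : ℝ)⁻¹ • hessMatrix N (μ * gammaOne N)) z := by
  have hN' : (0 : ℝ) < N := Nat.cast_pos.2 (NeZero.pos N)
  set c := diagonalConst μ ρ with hc
  have hc0 : 0 < c := diagonalConst_pos hμ hρ
  set C := sobolevConst μ c with hC
  have hC0 : 0 < C := sobolevConst_pos hμ hc0
  set A := (N * ε : ℝ)⁻¹ • hessMatrix N (μ * gammaOne N) with hAdef
  set A' := (N * ε : ℝ)⁻¹ • lowerMatrix N (μ * gammaOne N) ((1 + μ) / 2) c with hA'def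
  have hb : ∀ i, ∀ w : ZMod N → ℝ, w i ^ 2 ≤ C * ε * (w ⬝ᵥ A *ᵥ w) :=
    sq_le_smul_of_sq_le hε (sq_le_hessMatrix hN hμ hc0)
  have hb' : ∀ i, ∀ w : ZMod N → ℝ, w i ^ 2 ≤ C * ε * (w ⬝ᵥ A' *ᵥ w) :=
    sq_le_smul_of_sq_le hε (sq_le_lowerMatrix hN hμ hc0)
  have hA : A.PosDef :=
    posDef_of_sq_le ((isHermitian_hessMatrix _).smul (.all _)) (mul_pos hC0 hε) hb
  have hA' : A'.PosDef :=
    posDef_of_sq_le ((isHermitian_lowerMatrix _ _ _).smul (.all _)) (mul_pos hC0 hε) hb'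
  obtain ⟨i1, m1⟩ := integral_sum_sq_mul_gaussDensity_le hA hC0 hε hb (pow_pos hρ 2)
  obtain ⟨i2, m2⟩ := integral_abs_anharmonic_mul_gaussDensity_le hA hC0 hε hε1 hb
  obtain ⟨i3, m3⟩ := integral_abs_anharmonic_mul_gaussDensity_le hA' hC0 hε hε1 hb'
  have hdom : ∀ z, u z ≠ 0 → Real.exp (anharmonic N ε z) * gaussDensity A z
      ≤ gaussDensity A' z := by
    intro z hz
    have h := lowerMatrix_le (γ := μ * gammaOne N) hμ hρ hρ' fun hmem => hz (hu0 z hmem)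
    rw [gaussDensity, gaussDensity, ← Real.exp_add, anharmonic, hAdef, hA'def, smul_mulVec,
      smul_mulVec, dotProduct_smul, dotProduct_smul, smul_eq_mul, smul_eq_mul]
    refine Real.exp_le_exp.2 ?_
    have := mul_le_mul_of_nonneg_left h (by positivity : (0 : ℝ) ≤ (N * ε)⁻¹)
    linarith
  have hq : ∀ z, 1 - u z ≤ (ρ ^ 2 * N)⁻¹ * ∑ i, z i ^ 2 := by
    intro z
    by_cases hz : Iminus N + z ∈ Bminus N ρ
    · rw [hu1 z hz, sub_self]
      exact mul_nonneg (by positivity) (Finset.sum_nonneg fun _ _ => sq_nonneg _)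
    · have h1 := sum_sq_ge_of_notMem_Bminus hρ hz
      have h2 : 1 ≤ (ρ ^ 2 * N)⁻¹ * ∑ i, z i ^ 2 := by
        rw [inv_mul_eq_div, one_le_div (by positivity)]
        exact h1
      linarith [(hu z).1]
  have hmain := abs_integral_mul_exp_mul_sub_le hu (fun z => (gaussDensity_pos A z).le)
    (fun z => (gaussDensity_pos A' z).le) hdom hq hum
    (continuous_anharmonic ε).aestronglyMeasurable (integrable_gaussDensity hA)
    (integrable_gaussDensity hA') i1 i2 i3
  have hZ : 0 ≤ ∫ z, gaussDensity A z := integral_nonneg fun z => (gaussDensity_pos A z).le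
  -- A perturbation of order 1/(Nε), variances of order ε and N coordinates: the exponent is
  -- independent of N and ε.
  have hJ := integral_gaussDensity_le_of_le_add hA hA' (c := (N * ε : ℝ)⁻¹ * (2 + (1 + μ) / 2))
    (by positivity) (by positivity : 0 < C * ε) (fun w => by
      rw [hAdef, hA'def, smul_mulVec, smul_mulVec, dotProduct_smul, dotProduct_smul, smul_eq_mul,
        smul_eq_mul, mul_assoc, ← mul_add]
      exact mul_le_mul_of_nonneg_left
        (hessMatrix_le_lowerMatrix_add (by linarith) hc0.le w) (by positivity)) hb'
  have e : 4 * ((N * ε : ℝ)⁻¹ * (2 + (1 + μ) / 2)) * (C * ε) * (Fintype.card (ZMod N) : ℝ)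
      = 4 * (2 + (1 + μ) / 2) * C := by
    rw [ZMod.card]
    field_simp
  rw [e] at hJ
  set Z := ∫ z, gaussDensity A z
  set Z' := ∫ z, gaussDensity A' z
  have hs0 : 0 ≤ √ε := Real.sqrt_nonneg _
  have hsε : √ε ^ 2 = ε := Real.sq_sqrt hε.le
  have hε_le : ε ≤ √ε := by
    have := Real.sqrt_le_one.2 hε1
    nlinarith
  have t1 : 8 * C / ρ ^ 2 * ε * Z ≤ 8 * C / ρ ^ 2 * √ε * Z := by gcongr
  have t3 : (8 * C + 80 * C ^ 2) * √ε * Z'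
      ≤ (8 * C + 80 * C ^ 2) * √ε * (Real.exp (4 * (2 + (1 + μ) / 2) * C) * Z) := by gcongr
  have hfin : massConst μ ρ * √ε * Z = 8 * C / ρ ^ 2 * √ε * Z + (8 * C + 80 * C ^ 2) * √ε * Z
      + (8 * C + 80 * C ^ 2) * √ε * (Real.exp (4 * (2 + (1 + μ) / 2) * C) * Z) := by
    simp only [massConst, ← hc, ← hC]
    ring
  rw [hfin]
  linarith

lemma integral_gaussDensity_hessMatrix (hN : 2 ≤ N) {μ ε : ℝ} (hμ : 1 < μ) (hε : 0 < ε) :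
    ∫ z, gaussDensity ((N * ε : ℝ)⁻¹ • hessMatrix N (μ * gammaOne N)) z
      = (N : ℝ) ^ ((N : ℝ) / 2)
        * (√(2 * Real.pi * ε) ^ N / √((hessMatrix N (μ * gammaOne N)).det)) := by
  have hN' : (0 : ℝ) < N := Nat.cast_pos.2 (NeZero.pos N)
  rw [integral_gaussDensity (posDef_smul_hessMatrix hN hμ hε), det_smul, ZMod.card,
    Real.sqrt_mul (by positivity : 0 ≤ (N * ε : ℝ)⁻¹ ^ N)]
  have h1 : √((N * ε : ℝ)⁻¹ ^ N) = (√N ^ N * √ε ^ N)⁻¹ := by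
    rw [Real.sqrt_eq_rpow, ← Real.rpow_natCast_mul (by positivity), mul_comm (N : ℝ) (1 / 2),
      Real.rpow_mul (by positivity), ← Real.sqrt_eq_rpow, Real.rpow_natCast, Real.sqrt_inv,
      Real.sqrt_mul hN'.le, inv_pow, mul_pow]
  have h2 : (N : ℝ) ^ ((N : ℝ) / 2) = √N ^ N := by
    rw [Real.sqrt_eq_rpow, ← Real.rpow_natCast, ← Real.rpow_mul hN'.le]
    congr 1
    ring
  rw [h1, h2, Real.sqrt_mul (by positivity : 0 ≤ 2 * Real.pi) ε, mul_pow]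
  have hs : 0 < √(N : ℝ) := Real.sqrt_pos.2 hN'
  have hs2 : 0 < √ε := Real.sqrt_pos.2 hε
  field_simp

/-- The bound x⁴/4 - x²/2 ≥ x²/2 - 1, that is (x² - 2)² ≥ 0, reduces this to a Gaussian. -/
lemma integrable_exp_neg_potentialG {γ ε : ℝ} (hγ : 0 ≤ γ) (hε : 0 < ε) :
    Integrable fun x : Conf N => Real.exp (-potentialG γ x / ε) := by
  have hN : (0 : ℝ) < N := Nat.cast_pos.2 (NeZero.pos N)
  have hP : ((N * ε : ℝ)⁻¹ • (1 : Matrix (ZMod N) (ZMod N) ℝ)).PosDef :=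
    PosDef.one.smul (by positivity)
  refine ((integrable_gaussDensity hP).const_mul (Real.exp (1 / ε))).mono'
    (Continuous.aestronglyMeasurable ?_) (Filter.Eventually.of_forall fun x => ?_)
  · have := continuous_potentialG (N := N) γ
    fun_prop
  rw [Real.norm_of_nonneg (Real.exp_pos _).le, gaussDensity, ← Real.exp_add, smul_mulVec,
    one_mulVec, dotProduct_smul, smul_eq_mul]
  refine Real.exp_le_exp.2 ?_
  have h1 : (∑ i, x i ^ 2) / 2 - N ≤ potentialF γ x := by
    rw [potentialF]
    have h2 : 0 ≤ γ / 4 * ∑ i, (x i - x (i + 1)) ^ 2 :=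
      mul_nonneg (by positivity) (Finset.sum_nonneg fun _ _ => sq_nonneg _)
    have h3 : ∑ i, (x i ^ 2 / 2 - 1)
        ≤ ∑ i, ((1 / 4 : ℝ) * x i ^ 4 - (1 / 2 : ℝ) * x i ^ 2) :=
      Finset.sum_le_sum fun i _ => by nlinarith [sq_nonneg (x i ^ 2 - 2)]
    rw [Finset.sum_sub_distrib, ← Finset.sum_div] at h3
    simp only [Finset.sum_const, Finset.card_univ, ZMod.card, nsmul_eq_mul, mul_one] at h3
    linarith
  have e : x.ofLp ⬝ᵥ x.ofLp = ∑ i, x i ^ 2 := by simp [dotProduct, pow_two]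
  rw [e, potentialG]
  have h4 := mul_le_mul_of_nonneg_left h1 (by positivity : (0 : ℝ) ≤ (N * ε)⁻¹)
  have e1 : -((N : ℝ)⁻¹ * potentialF γ x) / ε = -((N * ε)⁻¹ * potentialF γ x) := by field_simp
  have e2 : (N * ε : ℝ)⁻¹ * ((∑ i, x i ^ 2) / 2 - N)
      = (N * ε : ℝ)⁻¹ * (∑ i, x i ^ 2) / 2 - 1 / ε := by field_simp
  rw [e1]
  linarith

lemma dist_Iplus_Iminus : dist (Iplus N) (Iminus N) = 2 * √(N : ℝ) := by
  rw [EuclideanSpace.dist_eq]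
  have : ∀ i : ZMod N, dist ((Iplus N) i) ((Iminus N) i) ^ 2 = 4 := fun i => by
    simp [Iplus, Iminus, Real.dist_eq]
    norm_num
  simp only [this, Finset.sum_const, Finset.card_univ, ZMod.card, nsmul_eq_mul]
  rw [mul_comm, Real.sqrt_mul (by norm_num)]
  congr 1
  rw [show (4 : ℝ) = 2 ^ 2 by norm_num, Real.sqrt_sq (by norm_num)]

lemma exists_isAdmissible {V : Conf N → ℝ} {ε ρ : ℝ} [IsFiniteMeasure (gibbs V ε)]
    (hρ : 0 < ρ) (hρ' : ρ < 1) :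
    ∃ h g, IsAdmissible V ε (Bminus N ρ) (Bplus N ρ) h g := by
  have hN : (0 : ℝ) < N := Nat.cast_pos.2 (NeZero.pos N)
  have hs : 0 < √(N : ℝ) := Real.sqrt_pos.2 hN
  -- The centres are 2√N apart, so the outer radius reaches just to the ball around `I_+`; ρ < 1
  -- keeps it larger than the inner one.
  let f : ContDiffBump (Iminus N) := ⟨ρ * √(N : ℝ), (2 - ρ) * √(N : ℝ), by positivity, by
    gcongr
    linarith⟩
  have hf : ContDiff ℝ 1 f := f.contDiff
  refine ⟨f, gradient f, hasWeakGradient_of_contDiff hf,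
    f.continuous.memLp_of_hasCompactSupport f.hasCompactSupport,
    (continuous_gradient hf).memLp_of_hasCompactSupport
      (hasCompactSupport_gradient f.hasCompactSupport),
    fun x => ⟨f.nonneg, f.le_one⟩,
    fun x hx => f.one_of_mem_closedBall (Metric.ball_subset_closedBall hx), fun x hx => ?_⟩
  refine f.zero_of_le_dist ?_
  have h1 := dist_triangle (Iplus N) x (Iminus N)
  rw [dist_Iplus_Iminus, dist_comm (Iplus N) x] at h1
  have h2 : dist x (Iplus N) < ρ * √(N : ℝ) := hx
  change (2 - ρ) * √(N : ℝ) ≤ _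
  linarith

lemma sqrt_le_sqrt_mul_abs_log {ε : ℝ} (hε : 0 < ε) (hε1 : ε < Real.exp (-1)) :
    √ε ≤ √(ε * |Real.log ε| ^ 3) := by
  refine Real.sqrt_le_sqrt ?_
  have h1 : Real.log ε < -1 := by
    rw [← Real.log_exp (-1)]
    exact Real.log_lt_log hε hε1
  have h2 : 1 ≤ |Real.log ε| := by
    rw [abs_of_neg (by linarith)]
    linarith
  exact le_mul_of_one_le_right hε.le (one_le_pow₀ h2)

lemma setIntegral_compl_Bplus_eq {γ ρ ε : ℝ} (hε : 0 < ε) (h : Conf N → ℝ) :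
    ∫ x in (Bplus N ρ)ᶜ, h x * Real.exp (-potentialG γ x / ε)
      = Real.exp (1 / (4 * ε)) * ∫ z : Conf N, (Bplus N ρ)ᶜ.indicator h (Iminus N + z)
        * (Real.exp (anharmonic N ε z) * gaussDensity ((N * ε : ℝ)⁻¹ • hessMatrix N γ) z) := by
  have hm : MeasurableSet (Bplus N ρ)ᶜ := Metric.isOpen_ball.measurableSet.compl
  rw [← integral_indicator hm, ← integral_const_mul,
    ← integral_add_left_eq_self _ (Iminus N)]
  refine integral_congr_ae (Filter.Eventually.of_forall fun z => ?_)
  simp only [indicator_mul_left, exp_neg_potentialG_Iminus_add γ hε z]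
  ring

end Mass

end CoupledBistable

end

/-! ### The main theorem -/

open CoupledBistable in
theorem proposition4p7 (μ : ℝ) (hμ : 1 < μ) (ρ : ℝ) (hρ : 0 < ρ) (hρ' : ρ < 1) :
    ∃ A₆ : ℝ, ∃ ε₀ : ℝ, 0 < ε₀ ∧
      ∀ ε : ℝ, 0 < ε → ε < ε₀ →
      ∀ (N : ℕ) [NeZero N], 2 ≤ N →
      ∀ γ : ℝ, γ = μ * gammaOne N →
        (∃ h : Conf N → ℝ,
          IsEquilibriumPotential (potentialG γ) ε (Bminus N ρ) (Bplus N ρ) h) ∧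
        ∀ h : Conf N → ℝ,
          IsEquilibriumPotential (potentialG γ) ε (Bminus N ρ) (Bplus N ρ) h →
          ∃ R : ℝ, |R| ≤ A₆ * √(ε * |Real.log ε| ^ 3) ∧
            1 / (N : ℝ) ^ ((N : ℝ) / 2) *
                ∫ x in (Bplus N ρ)ᶜ, h x * Real.exp (-potentialG γ x / ε) =
              √(2 * Real.pi * ε) ^ N * Real.exp (1 / (4 * ε)) /
                  √((hessian (potentialF γ) (Iminus N)).det) * (1 + R) := by
  -- Below e⁻¹ one has |ln ε| ≥ 1, so an error of order √ε suffices.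
  refine ⟨massConst μ ρ, Real.exp (-1), Real.exp_pos _, fun ε hε hε0 N _ hN γ hγ => ?_⟩
  subst hγ
  have hN' : (0 : ℝ) < N := Nat.cast_pos.2 (NeZero.pos N)
  have hε1 : ε ≤ 1 := hε0.le.trans (Real.exp_le_one_iff.2 (by norm_num))
  have hγ0 : 0 ≤ μ * gammaOne N := mul_nonneg (by linarith) (gammaOne_pos hN).le
  have hint := integrable_exp_neg_potentialG (N := N) hγ0 hε
  have := isFiniteMeasure_gibbs hint
  refine ⟨exists_isEquilibriumPotential (continuous_potentialG _) hε hint Metric.isOpen_ball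
    Metric.isOpen_ball (exists_isAdmissible hρ hρ'), ?_⟩
  rintro h ⟨g, H, -⟩
  have hm : AEStronglyMeasurable ((Bplus N ρ)ᶜ.indicator h) (volume : Measure (Conf N)) :=
    (H.memLp.1.mono_ac (volume_absolutelyContinuous_gibbs (continuous_potentialG _) ε)).indicator
      Metric.isOpen_ball.measurableSet.compl
  have hmass := abs_integral_mass_sub_le hN hμ hρ hρ' hε hε1
    (u := fun z => (Bplus N ρ)ᶜ.indicator h (Iminus N + z))
    (fun z => by
      by_cases hz : Iminus N + z ∈ (Bplus N ρ)ᶜ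
      · rw [indicator_of_mem hz]
        exact H.mem_Icc _
      · rw [indicator_of_notMem hz]
        simp)
    (hm.comp_measurePreserving (measurePreserving_add_left volume (Iminus N)))
    (fun z hz => by
      rw [indicator_of_mem, H.eq_one _ hz]
      intro hz'
      -- Disjointness of the balls is read off from h, which cannot be both 1 and 0.
      have h0 := H.eq_zero _ hz'
      rw [H.eq_one _ hz] at h0
      exact one_ne_zero h0)
    (fun z hz => indicator_of_notMem (by simpa using hz) _)
  rw [integral_gaussDensity_hessMatrix hN hμ hε] at hmass
  rw [setIntegral_compl_Bplus_eq hε, hessian_potentialF_Iminus]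
  have hdet : 0 < (hessMatrix N (μ * gammaOne N)).det := by
    have hK := div_pos (sobolevConst_pos hμ one_pos) hN'
    exact (posDef_of_sq_le (isHermitian_hessMatrix _) hK (sq_le_hessMatrix hN hμ one_pos)).det_pos
  set I := ∫ z : Conf N, (Bplus N ρ)ᶜ.indicator h (Iminus N + z)
    * (Real.exp (anharmonic N ε z)
      * gaussDensity ((N * ε : ℝ)⁻¹ • hessMatrix N (μ * gammaOne N)) z)
  set P := (N : ℝ) ^ ((N : ℝ) / 2)
  have hP : 0 < P := by positivity
  set T := √(2 * Real.pi * ε) ^ N with hT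
  have hT0 : 0 < T := by positivity
  set d := √((hessMatrix N (μ * gammaOne N)).det)
  have hd : 0 < d := Real.sqrt_pos.2 hdet
  refine ⟨I / (P * (T / d)) - 1, ?_, ?_⟩
  · refine le_trans ?_ (mul_le_mul_of_nonneg_left (sqrt_le_sqrt_mul_abs_log hε hε0)
      (massConst_pos hμ hρ).le)
    have hZ : 0 < P * (T / d) := by positivity
    rw [div_sub_one hZ.ne', abs_div, abs_of_pos hZ, div_le_iff₀ hZ]
    exact hmass
  · field_simp
    ring
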